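/- Let $\lambda,\mu>0$. For each integer $N\ge 0$ let $X^{(N)}=(X^{(N)}_t)_{t\ge 0}$ be the asymmetric continuous-time Ehrenfest process with rates $\lambda,\mu$ started at $0$, that is, the continuous-time Markov chain on $\{0,\dots,N\}$ with right-continuous paths and $X^{(N)}_0=0$ which jumps from $i$ to $i+1$ at rate $\lambda(N-i)$ and from $i$ to $i-1$ at rate $\mu i$. Let $\pi^{(N)}_t$ be the distribution of $X^{(N)}_t$, let $\pi^{(N)}$ be the stationary distribution of the chain, and let $$d^{(N)}(t)=\|\pi^{(N)}_t-\pi^{(N)}\|_{TV}=\tfrac12\sum_{x=0}^N|\pi^{(N)}_t(x)-\pi^{(N)}(x)|.$$ A state $x$ is called a halting state if $d^{(N)}(t)\le \mathbb P(T_x>t)$ for all $t\ge 0$, where $T_x=\inf\{t\ge 0: X^{(N)}_t=x\}$. 1. For every $N$, the smallest halting state of $X^{(N)}$ is $x^*=\lceil \frac{\lambda}{\lambda+\mu}N\rceil$; moreover, $x^*$ is also the smallest state $x$ such that $\pi^{(N)}_t(x)\le\pi^{(N)}(x)$ for all $t\ge 0$. 2. The family $(X^{(N)})_N$ has a total variation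 cutoff at time $t_N=\frac{\log N}{2(\lambda+\mu)}$: as $N\to\infty$, $d^{(N)}(c\,t_N)\to 0$ for every $c>1$, and $d^{(N)}(c\,t_N)\to 1$ for every $0\le c<1$. -/

import Mathlib

open MeasureTheory Filter Topology Matrix
open scoped NNReal

noncomputable section

namespace EhrenfestCutoff

/-- `(X_t)_{t ≥ 0}` is a continuous-time Markov chain on the finite set `S` with generator `Q` and
initial distribution `ν`: its paths are right-continuous step functions and its finite-dimensional
distributions are those given by `ν` and the semigroup `exp (t Q)`. -/
structure IsMarkovChain {Ω S : Type*} [MeasurableSpace Ω] [Fintype S] [DecidableEq S]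
    (P : Measure Ω) (Q : Matrix S S ℝ) (ν : S → ℝ) (X : ℝ≥0 → Ω → S) : Prop where
  measurable : ∀ (t : ℝ≥0) (x : S), MeasurableSet {ω | X t ω = x}
  rightContinuous : ∀ (ω : Ω) (t : ℝ≥0), ∀ᶠ s in 𝓝[>] t, X s ω = X t ω
  finiteDimensional : ∀ (n : ℕ) (t : ℕ → ℝ≥0) (x : ℕ → S), Monotone t →
    P.real {ω | ∀ k ≤ n, X (t k) ω = x k} =
      (ν ᵥ* NormedSpace.exp ((t 0 : ℝ) • Q)) (x 0) *
        ∏ k ∈ Finset.range n,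
          NormedSpace.exp (((t (k + 1) : ℝ) - (t k : ℝ)) • Q) (x k) (x (k + 1))

/-- `π` is a stationary probability distribution of the chain with generator `Q`. -/
structure IsStationary {S : Type*} [Fintype S] (Q : Matrix S S ℝ) (π : S → ℝ) : Prop where
  nonneg : ∀ x, 0 ≤ π x
  sum_eq_one : ∑ x, π x = 1
  invariant : π ᵥ* Q = 0

/-- The distribution `π_t` of `X_t`, as a function on the state space. -/
def law {Ω S : Type*} [MeasurableSpace Ω] (P : Measure Ω) (X : ℝ≥0 → Ω → S) (t : ℝ≥0) : S → ℝ :=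
  fun x => P.real {ω | X t ω = x}

/-- Total variation distance between two probability distributions on a finite set. -/
def tvDist {S : Type*} [Fintype S] (p q : S → ℝ) : ℝ :=
  (1 / 2) * ∑ x, |p x - q x|

/-- `d(t)`: the total variation distance between the distribution of `X_t` and `π`. -/
def dist {Ω S : Type*} [MeasurableSpace Ω] [Fintype S]
    (P : Measure Ω) (X : ℝ≥0 → Ω → S) (π : S → ℝ) (t : ℝ≥0) : ℝ :=
  tvDist (law P X t) π

/-- `A` is a halting set (for the total variation distance): `d(t) ≤ P(T_A > t)` for all `t ≥ 0`,
where `T_A = inf {t ≥ 0 | X_t ∈ A}`, with value `⊤` if `A` is never hit. -/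
def IsHaltingSet {Ω S : Type*} [MeasurableSpace Ω] [Fintype S]
    (P : Measure Ω) (X : ℝ≥0 → Ω → S) (π : S → ℝ) (A : Set S) : Prop :=
  ∀ t : ℝ≥0, dist P X π t ≤ P.real {ω | (t : WithTop ℝ≥0) < hittingAfter X A 0 ω}

/-- The state `x` is a halting state. -/
def IsHaltingState {Ω S : Type*} [MeasurableSpace Ω] [Fintype S]
    (P : Measure Ω) (X : ℝ≥0 → Ω → S) (π : S → ℝ) (x : S) : Prop :=
  IsHaltingSet P X π {x}

/-- The set `{x | ∀ t ≥ 0, π_t(x) ≤ π(x)}`. -/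
def dominatedStates {Ω S : Type*} [MeasurableSpace Ω]
    (P : Measure Ω) (X : ℝ≥0 → Ω → S) (π : S → ℝ) : Set S :=
  {x | ∀ t : ℝ≥0, law P X t x ≤ π x}

/-- A family of chains with distances to stationarity `d N t` has a cutoff at the times `τ N`. -/
def HasCutoff (d : ℕ → ℝ≥0 → ℝ) (τ : ℕ → ℝ≥0) : Prop :=
  (∀ c : ℝ≥0, 1 < c → Tendsto (fun N => d N (c * τ N)) atTop (𝓝 0)) ∧
  (∀ c : ℝ≥0, c < 1 → Tendsto (fun N => d N (c * τ N)) atTop (𝓝 1))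

/-- Generator of the asymmetric continuous-time Ehrenfest process on `{0, …, N}`:
`i → i + 1` at rate `lam * (N - i)` and `i → i - 1` at rate `mu * i`. -/
def ehrenfestGenerator (lam mu : ℝ) (N : ℕ) : Matrix (Fin (N + 1)) (Fin (N + 1)) ℝ :=
  Matrix.of fun i j =>
    if (j : ℕ) = (i : ℕ) + 1 then lam * ((N : ℝ) - ((i : ℕ) : ℝ))
    else if (i : ℕ) = (j : ℕ) + 1 then mu * ((i : ℕ) : ℝ)
    else if i = j then -(lam * ((N : ℝ) - ((i : ℕ) : ℝ)) + mu * ((i : ℕ) : ℝ))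
    else 0

/-- `X` is an asymmetric Ehrenfest process on `{0, …, N}` with rates `lam`, `mu`, started at `0`. -/
def IsEhrenfestProcess {Ω : Type*} [MeasurableSpace Ω] (P : Measure Ω) (lam mu : ℝ) (N : ℕ)
    (X : ℝ≥0 → Ω → Fin (N + 1)) : Prop :=
  IsMarkovChain P (ehrenfestGenerator lam mu N) (Pi.single 0 1) X

end EhrenfestCutoff

end

namespace EhrenfestCutoff

/-! ### Transition semigroups of finite generators. -/

section Semigroup

variable {S : Type*} [Fintype S] [DecidableEq S]

/-! Put p = λ/(λ+μ) and s(t) = p(1 - e^{-(λ+μ)t}). Binomial laws are preserved by the dynamics, so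
X_t is Bin(N, s(t)) and π is Bin(N, p) (`single_vecMul_exp`, `IsStationary.eq_binomialWeight`).
Every question becomes a comparison of two binomials.

The likelihood of k as a function of s peaks at k/N, and s(t) sweeps [0, p). Hence k is dominated by
π at all times exactly when k ≥ Np (`mem_dominatedStates_iff`).

If A consists of dominated states, then π_t - π stays below the law of the chain killed on A: on A
by domination, off A because positive transition probabilities preserve the inequality. Summing
gives d(t) ≤ P(T_A > t), and T_x ≥ T_A for x in A. Thus states x ≥ Np are halting.

Conversely, comparing means gives d(t) ≥ (p/2) e^{-(λ+μ)t}. For 0 < x < Np the function (x - i)⁺ is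
a Lyapunov function showing that P(T_x > t) decays at a rate above λ+μ, so x cannot be halting; x =
0 fails at t = 0.

For the cutoff, both the chi-square upper bound and the Chebyshev lower bound depend on N(p - s)²,
which equals p² N^{1-c} at time c·t_N. -/

lemma exp_nonneg_of_nonneg {A : Matrix S S ℝ} (hA : ∀ i j, 0 ≤ A i j) (i j : S) :
    0 ≤ NormedSpace.exp A i j := by
  let _ : NormedRing (Matrix S S ℝ) := Matrix.linftyOpNormedRing
  let _ : NormedAlgebra ℝ (Matrix S S ℝ) := Matrix.linftyOpNormedAlgebra
  have hpow : ∀ n : ℕ, ∀ i j, 0 ≤ (A ^ n) i j := by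
    intro n
    induction n with
    | zero => intro i j; rw [pow_zero, Matrix.one_apply]; split_ifs <;> norm_num
    | succ n ih =>
      intro i j
      rw [pow_succ, Matrix.mul_apply]
      exact Finset.sum_nonneg fun k _ => mul_nonneg (ih _ _) (hA _ _)
  have h := NormedSpace.exp_series_hasSum_exp' (𝕂 := ℝ) A
  have h2 := (Pi.hasSum.1 (Pi.hasSum.1 h i)) j
  refine h2.nonneg fun n => ?_
  simp only [Matrix.smul_apply, smul_eq_mul]
  exact mul_nonneg (by positivity) (hpow n i j)

/-- The transition probabilities `exp (t Q)` are nonnegative. -/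
lemma exp_smul_nonneg {Q : Matrix S S ℝ} (hQ : ∀ i j, i ≠ j → 0 ≤ Q i j) {t : ℝ} (ht : 0 ≤ t)
    (i j : S) : 0 ≤ NormedSpace.exp (t • Q) i j := by
  -- Shifting by c times the identity makes all entries of Q nonnegative and changes the exponential
  -- only by a positive scalar factor.
  set c : ℝ := ∑ i, |Q i i| with hc
  have hsplit : t • Q = t • (Q + c • (1 : Matrix S S ℝ)) + (-(t * c)) • (1 : Matrix S S ℝ) := by
    rw [smul_add, smul_smul, neg_smul, add_neg_cancel_right]
  have hone : NormedSpace.exp ((-(t * c)) • (1 : Matrix S S ℝ))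
      = Real.exp (-(t * c)) • (1 : Matrix S S ℝ) := by
    rw [Matrix.smul_one_eq_diagonal, Matrix.exp_diagonal, Matrix.smul_one_eq_diagonal]
    congr 1
    rw [Real.exp_eq_exp_ℝ]
    ext k
    rw [Pi.coe_exp]
  rw [hsplit, Matrix.exp_add_of_commute _ _
    ((Commute.one_right (t • (Q + c • (1 : Matrix S S ℝ)))).smul_right _), hone, mul_smul_comm,
    mul_one, Matrix.smul_apply, smul_eq_mul]
  refine mul_nonneg (Real.exp_pos _).le (exp_nonneg_of_nonneg (fun k l => ?_) i j)
  rw [Matrix.smul_apply, smul_eq_mul, Matrix.add_apply, Matrix.smul_apply, smul_eq_mul]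
  refine mul_nonneg ht ?_
  by_cases hkl : k = l
  · subst hkl
    rw [Matrix.one_apply_eq, mul_one]
    have : |Q k k| ≤ c := Finset.single_le_sum (f := fun i => |Q i i|) (fun i _ => abs_nonneg _)
      (Finset.mem_univ k)
    have h2 := neg_abs_le (Q k k)
    linarith
  · rw [Matrix.one_apply_ne hkl, mul_zero, add_zero]
    exact hQ k l hkl

lemma hasDerivAt_exp_smul_apply (Q : Matrix S S ℝ) (i j : S) (t : ℝ) :
    HasDerivAt (fun u : ℝ => NormedSpace.exp (u • Q) i j) ((Q * NormedSpace.exp (t • Q)) i j) t := by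
  let _ : NormedRing (Matrix S S ℝ) := Matrix.linftyOpNormedRing
  let _ : NormedAlgebra ℝ (Matrix S S ℝ) := Matrix.linftyOpNormedAlgebra
  have h := hasDerivAt_exp_smul_const' (𝕂 := ℝ) Q t
  exact (hasDerivAt_pi.1 (hasDerivAt_pi.1 h i)) j

/-- Solutions of the forward equation are given by the semigroup. -/
lemma eq_vecMul_exp {Q : Matrix S S ℝ} {b : ℝ → S → ℝ}
    (hb : ∀ t x, HasDerivAt (fun u => b u x) ((b t ᵥ* Q) x) t) (t : ℝ) :
    b t = b 0 ᵥ* NormedSpace.exp (t • Q) := by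
  -- The curve s ↦ b_s exp((t-s)Q) joins b_0 exp(tQ) to b_t; the forward and backward derivatives
  -- cancel along it.
  have hconst : ∀ y u, HasDerivAt
      (fun s => ∑ x, b s x * NormedSpace.exp ((t - s) • Q) x y) 0 u := by
    intro y u
    have h1 : ∀ x, HasDerivAt (fun s => NormedSpace.exp ((t - s) • Q) x y)
        (-(Q * NormedSpace.exp ((t - u) • Q)) x y) u := by
      intro x
      have := (hasDerivAt_exp_smul_apply Q x y (t - u)).comp u ((hasDerivAt_id u).const_sub t)
      simpa using! this
    have h2 := HasDerivAt.fun_sum (u := Finset.univ) fun x _ => (hb u x).mul (h1 x)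
    convert! h2 using 1
    rw [Finset.sum_add_distrib]
    have e1 : ∑ x, (b u ᵥ* Q) x * NormedSpace.exp ((t - u) • Q) x y
        = (b u ᵥ* Q ᵥ* NormedSpace.exp ((t - u) • Q)) y := rfl
    have e2 : ∑ x, b u x * -(Q * NormedSpace.exp ((t - u) • Q)) x y
        = -(b u ᵥ* (Q * NormedSpace.exp ((t - u) • Q))) y := by
      simp [Matrix.vecMul, dotProduct]
    rw [e1, e2, Matrix.vecMul_vecMul]
    ring
  ext y
  have := is_const_of_deriv_eq_zero (fun u => (hconst y u).differentiableAt)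
    (fun u => (hconst y u).deriv) t 0
  simp only [sub_self, zero_smul, sub_zero, NormedSpace.exp_zero] at this
  have e : ∑ x, b t x * (1 : Matrix S S ℝ) x y = b t y := by
    simp [Matrix.one_apply]
  rw [e] at this
  exact this

lemma vecMul_exp_of_invariant {Q : Matrix S S ℝ} {π : S → ℝ} (h : π ᵥ* Q = 0) (t : ℝ) :
    π ᵥ* NormedSpace.exp (t • Q) = π :=
  (eq_vecMul_exp (b := fun _ => π) (fun t x => by rw [h]; exact hasDerivAt_const _ _) t).symm

end Semigroup

/-! ### Halting sets and hitting times of general chains. -/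

section Paths

variable {Ω S : Type*} [MeasurableSpace Ω] [Fintype S] [DecidableEq S] {P : Measure Ω}
  [IsProbabilityMeasure P] {Q : Matrix S S ℝ} {ν : S → ℝ} {X : ℝ≥0 → Ω → S}

/-- Additivity is applied to P restricted to F, so only the fibres need to be measurable, not F. -/
lemma measureReal_eq_sum_fibers {T : Type*} [Fintype T] (P : Measure Ω) [IsProbabilityMeasure P]
    {Y : Ω → T} (hY : ∀ y, MeasurableSet {ω | Y ω = y}) (F : Set Ω) :
    P.real F = ∑ y, P.real (F ∩ {ω | Y ω = y}) := by
  classical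
  let _ : MeasurableSpace T := ⊤
  have hm : Measurable Y := by
    refine measurable_to_countable' fun y => ?_
    exact hY y
  have h := measureReal_biUnion_finset (μ := P.restrict F) (s := (Finset.univ : Finset T))
    (f := fun y => {ω | Y ω = y}) (by
      intro a _ b _ hab
      exact Set.disjoint_left.2 fun ω ha hb => hab (ha.symm.trans hb)) (fun y _ => hY y)
  have hu : (⋃ y ∈ (Finset.univ : Finset T), {ω | Y ω = y}) = Set.univ := by
    ext ω; simp
  rw [hu] at h
  simp only [measureReal_restrict_apply MeasurableSet.univ, Set.univ_inter] at h
  rw [h]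
  refine Finset.sum_congr rfl fun y _ => ?_
  rw [measureReal_restrict_apply (hY y), Set.inter_comm]

lemma IsMarkovChain.law_eq (hX : IsMarkovChain P Q ν X) (t : ℝ≥0) :
    law P X t = ν ᵥ* NormedSpace.exp ((t : ℝ) • Q) := by
  ext x
  have := hX.finiteDimensional 0 (fun _ => t) (fun _ => x) monotone_const
  simpa [law] using this

lemma IsMarkovChain.sum_law (hX : IsMarkovChain P Q ν X) (t : ℝ≥0) : ∑ x, law P X t x = 1 := by
  have := measureReal_eq_sum_fibers P (hX.measurable t) Set.univ
  simpa [law] using this.symm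

/-- The Markov property for events determined by the grid up to time `t n`. -/
lemma IsMarkovChain.measureReal_step (hX : IsMarkovChain P Q ν X) {t : ℕ → ℝ≥0} (ht : Monotone t)
    (n : ℕ) {F : Set Ω}
    (hF : ∀ ω ω', (∀ k ≤ n, X (t k) ω = X (t k) ω') → ω ∈ F → ω' ∈ F) (z y : S) :
    P.real (F ∩ {ω | X (t n) ω = z} ∩ {ω | X (t (n + 1)) ω = y}) =
      P.real (F ∩ {ω | X (t n) ω = z}) *
        NormedSpace.exp (((t (n + 1) : ℝ) - (t n : ℝ)) • Q) z y := by
  classical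
  -- Split by the whole history up to `t n`. A history decides membership in F, so each piece is
  -- empty or a finite-dimensional event.
  let Y : Ω → (Fin (n + 1) → S) := fun ω k => X (t k) ω
  have hY : ∀ f, MeasurableSet {ω | Y ω = f} := by
    intro f
    have : {ω | Y ω = f} = ⋂ k : Fin (n + 1), {ω | X (t k) ω = f k} := by
      ext ω; simp [Y, funext_iff]
    rw [this]
    exact MeasurableSet.iInter fun k => hX.measurable _ _
  rw [measureReal_eq_sum_fibers P hY, measureReal_eq_sum_fibers P hY (F ∩ {ω | X (t n) ω = z}),
    Finset.sum_mul]
  refine Finset.sum_congr rfl fun f _ => ?_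
  by_cases hne : (F ∩ {ω | X (t n) ω = z} ∩ {ω | Y ω = f}).Nonempty
  · obtain ⟨ω₀, ⟨h1, h2⟩, h3⟩ := hne
    let x : ℕ → S := fun k => if k ≤ n then X (t k) ω₀ else y
    have hmem : ∀ ω, Y ω = f ↔ ∀ k ≤ n, X (t k) ω = X (t k) ω₀ := by
      intro ω
      rw [← show Y ω₀ = f from h3]
      constructor
      · intro h k hk
        exact congrFun h ⟨k, by omega⟩
      · intro h
        ext k
        exact h k (by omega)
    have hx : ∀ k ≤ n, x k = X (t k) ω₀ := fun k hk => if_pos hk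
    have hx' : x (n + 1) = y := if_neg (by omega)
    have e1 : F ∩ {ω | X (t n) ω = z} ∩ {ω | Y ω = f} = {ω | ∀ k ≤ n, X (t k) ω = x k} := by
      ext ω
      simp only [Set.mem_inter_iff, Set.mem_ofPred_eq, hmem]
      constructor
      · rintro ⟨-, h⟩ k hk
        rw [hx k hk, h k hk]
      · intro h
        have h' : ∀ k ≤ n, X (t k) ω = X (t k) ω₀ := fun k hk => by rw [h k hk, hx k hk]
        exact ⟨⟨hF ω₀ ω (fun k hk => (h' k hk).symm) h1, (h' n le_rfl).trans h2⟩, h'⟩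
    have e2 : F ∩ {ω | X (t n) ω = z} ∩ {ω | X (t (n + 1)) ω = y} ∩ {ω | Y ω = f}
        = {ω | ∀ k ≤ n + 1, X (t k) ω = x k} := by
      rw [Set.inter_right_comm, e1]
      ext ω
      simp only [Set.mem_inter_iff, Set.mem_ofPred_eq]
      constructor
      · rintro ⟨h, h'⟩ k hk
        rcases Nat.lt_or_ge n k with hk' | hk'
        · obtain rfl : k = n + 1 := by omega
          rw [hx', h']
        · exact h k hk'
      · intro h
        exact ⟨fun k hk => h k (by omega), (h (n + 1) le_rfl).trans hx'⟩
    rw [e1, e2, hX.finiteDimensional _ t x ht, hX.finiteDimensional _ t x ht,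
      Finset.prod_range_succ, ← mul_assoc, hx', hx n le_rfl, show X (t n) ω₀ = z from h2]
  · rw [Set.not_nonempty_iff_eq_empty] at hne
    rw [Set.inter_right_comm, hne]
    simp

/-- Probability that the chain avoids `A` at the times `0, h, …, n h` and is at `y` at time `n h`. -/
noncomputable def gridAvoid (P : Measure Ω) (X : ℝ≥0 → Ω → S) (A : Set S) (h : ℝ≥0) (n : ℕ) (y : S) : ℝ :=
  P.real ({ω | ∀ k ≤ n, X (k * h) ω ∉ A} ∩ {ω | X (n * h) ω = y})

lemma gridAvoid_nonneg (A : Set S) (h : ℝ≥0) (n : ℕ) (y : S) : 0 ≤ gridAvoid P X A h n y :=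
  measureReal_nonneg

lemma gridAvoid_of_mem {A : Set S} (h : ℝ≥0) (n : ℕ) {y : S} (hy : y ∈ A) :
    gridAvoid P X A h n y = 0 := by
  have : {ω | ∀ k ≤ n, X (k * h) ω ∉ A} ∩ {ω | X (n * h) ω = y} = ∅ := by
    ext ω
    simp only [Set.mem_inter_iff, Set.mem_ofPred_eq, Set.mem_empty_iff_false, iff_false, not_and]
    intro h1 h2
    exact h1 n le_rfl (h2 ▸ hy)
  rw [gridAvoid, this]
  simp

lemma IsMarkovChain.sum_gridAvoid (hX : IsMarkovChain P Q ν X) (A : Set S) (h : ℝ≥0) (n : ℕ) :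
    ∑ y, gridAvoid P X A h n y = P.real {ω | ∀ k ≤ n, X (k * h) ω ∉ A} :=
  (measureReal_eq_sum_fibers P (hX.measurable _) _).symm

lemma grid_monotone (h : ℝ≥0) : Monotone fun k : ℕ => (k : ℝ≥0) * h := by
  intro a b hab
  have : (a : ℝ≥0) ≤ b := by exact_mod_cast hab
  dsimp only
  gcongr

lemma grid_sub (h : ℝ≥0) (n : ℕ) :
    (((((n + 1 : ℕ) : ℝ≥0) * h : ℝ≥0) : ℝ) - (((n : ℝ≥0) * h : ℝ≥0) : ℝ)) = h := by
  push_cast; ring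

/-- Ending at y outside A makes avoidance at the last grid time automatic, which leaves an event of
the past to which the Markov property applies. -/
lemma IsMarkovChain.gridAvoid_succ (hX : IsMarkovChain P Q ν X) (A : Set S) (h : ℝ≥0) (n : ℕ)
    {y : S} (hy : y ∉ A) :
    gridAvoid P X A h (n + 1) y
      = ∑ z, gridAvoid P X A h n z * NormedSpace.exp ((h : ℝ) • Q) z y := by
  have hset : {ω | ∀ k ≤ n + 1, X (k * h) ω ∉ A} ∩ {ω | X ((n + 1 : ℕ) * h) ω = y}
      = {ω | ∀ k ≤ n, X (k * h) ω ∉ A} ∩ {ω | X ((n + 1 : ℕ) * h) ω = y} := by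
    ext ω
    simp only [Set.mem_inter_iff, Set.mem_ofPred_eq]
    constructor
    · rintro ⟨h1, h2⟩
      exact ⟨fun k hk => h1 k (by omega), h2⟩
    · rintro ⟨h1, h2⟩
      refine ⟨fun k hk => ?_, h2⟩
      rcases Nat.lt_or_ge n k with hk' | hk'
      · obtain rfl : k = n + 1 := by omega
        rw [h2]; exact hy
      · exact h1 k hk'
  rw [gridAvoid, hset, measureReal_eq_sum_fibers P (hX.measurable (n * h))]
  refine Finset.sum_congr rfl fun z _ => ?_
  have := hX.measureReal_step (grid_monotone h) n (F := {ω | ∀ k ≤ n, X (k * h) ω ∉ A})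
    (fun ω ω' hω hF k hk => by rw [← hω k hk]; exact hF k hk) z y
  rw [grid_sub] at this
  rw [gridAvoid, ← this, Set.inter_right_comm]

lemma IsMarkovChain.law_succ (hX : IsMarkovChain P Q ν X) (h : ℝ≥0) (n : ℕ) (y : S) :
    law P X ((n + 1 : ℕ) * h) y
      = ∑ z, law P X (n * h) z * NormedSpace.exp ((h : ℝ) • Q) z y := by
  rw [law, measureReal_eq_sum_fibers P (hX.measurable (n * h))]
  refine Finset.sum_congr rfl fun z _ => ?_
  have := hX.measureReal_step (grid_monotone h) n (F := Set.univ) (fun _ _ _ _ => trivial) z y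
  rw [grid_sub] at this
  simp only [Set.univ_inter] at this
  rw [law, ← this, Set.inter_comm]

/-- Equal total masses make the distance the sum of the positive parts of p - q, and v dominates
these. -/
lemma tvDist_le_sum {p q v : S → ℝ} (hp : ∑ x, p x = 1) (hq : ∑ x, q x = 1)
    (hv : ∀ x, 0 ≤ v x) (h : ∀ x, p x - q x ≤ v x) : tvDist p q ≤ ∑ x, v x := by
  have h1 : ∀ x, |p x - q x| ≤ 2 * v x - (p x - q x) := fun x =>
    abs_le.2 ⟨by linarith [hv x], by linarith [h x]⟩
  have h2 := Finset.sum_le_sum fun x (_ : x ∈ Finset.univ) => h1 x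
  rw [Finset.sum_sub_distrib, Finset.sum_sub_distrib, hp, hq, ← Finset.mul_sum] at h2
  rw [tvDist]
  linarith

lemma le_tvDist {p q : S → ℝ} (hp : ∑ x, p x = 1) (hq : ∑ x, q x = 1) (s : Finset S) :
    ∑ x ∈ s, p x - ∑ x ∈ s, q x ≤ tvDist p q := by
  classical
  have h1 : ∑ x ∈ s, (p x - q x) ≤ ∑ x ∈ s, |p x - q x| :=
    Finset.sum_le_sum fun x _ => le_abs_self _
  have h2 : ∑ x ∈ sᶜ, (q x - p x) ≤ ∑ x ∈ sᶜ, |p x - q x| :=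
    Finset.sum_le_sum fun x _ => by rw [abs_sub_comm]; exact le_abs_self _
  have h3 := Finset.sum_add_sum_compl s fun x => |p x - q x|
  have h4 := Finset.sum_add_sum_compl s p
  have h5 := Finset.sum_add_sum_compl s q
  rw [Finset.sum_sub_distrib] at h1 h2
  rw [tvDist]
  linarith

/-- On a grid, the distance to stationarity is at most the probability of having avoided a set of
dominated states. -/
lemma IsMarkovChain.dist_le_grid (hX : IsMarkovChain P Q ν X) (hQ : ∀ i j, i ≠ j → 0 ≤ Q i j)
    {π : S → ℝ} (hπ : IsStationary Q π) {A : Set S} (hA : A ⊆ dominatedStates P X π)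
    (h : ℝ≥0) (n : ℕ) :
    dist P X π (n * h) ≤ P.real {ω | ∀ k ≤ n, X (k * h) ω ∉ A} := by
  -- The pointwise inequality, unlike the summed one, propagates by induction: on A the left side is
  -- nonpositive, and off A both sides evolve by the same nonnegative kernel because π is invariant.
  have key : ∀ (n : ℕ) y, law P X (n * h) y - π y ≤ gridAvoid P X A h n y := by
    intro n
    induction n with
    | zero =>
      intro y
      by_cases hy : y ∈ A
      · rw [gridAvoid_of_mem h _ hy]
        linarith [hA hy (((0 : ℕ) : ℝ≥0) * h)]
      · have : gridAvoid P X A h 0 y = law P X ((0 : ℕ) * h) y := by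
          rw [gridAvoid, law]
          congr 1
          ext ω
          simp only [Set.mem_inter_iff, Set.mem_ofPred_eq, and_iff_right_iff_imp]
          intro h1 k hk
          obtain rfl : k = 0 := by omega
          rw [h1]; exact hy
        rw [this]
        linarith [hπ.nonneg y]
    | succ n ih =>
      intro y
      by_cases hy : y ∈ A
      · rw [gridAvoid_of_mem h _ hy]
        linarith [hA hy (((n + 1 : ℕ) : ℝ≥0) * h)]
      · rw [hX.gridAvoid_succ A h n hy, hX.law_succ]
        have hinv := congrFun (vecMul_exp_of_invariant hπ.invariant (h : ℝ)) y
        rw [← hinv]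
        change _ - ∑ z, π z * _ ≤ _
        rw [← Finset.sum_sub_distrib]
        refine Finset.sum_le_sum fun z _ => ?_
        rw [← sub_mul]
        exact mul_le_mul_of_nonneg_right (ih z) (exp_smul_nonneg hQ h.2 z y)
  rw [← hX.sum_gridAvoid]
  exact tvDist_le_sum (hX.sum_law _) hπ.sum_eq_one (gridAvoid_nonneg A h n) (key n)

/-- The danger is an infimum equal to t approached by later hits. Right-continuity excludes it, as
the path keeps its value at t for a positive time. -/
lemma IsMarkovChain.lt_hittingAfter_iff (hX : IsMarkovChain P Q ν X) (A : Set S) (t : ℝ≥0) (ω : Ω) :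
    (t : WithTop ℝ≥0) < hittingAfter X A 0 ω ↔ ∀ s ≤ t, X s ω ∉ A := by
  constructor
  · intro h s hs
    exact notMem_of_lt_hittingAfter (lt_of_le_of_lt (WithTop.coe_le_coe.2 hs) h) zero_le
  · intro h
    rw [hittingAfter]
    split_ifs with hex
    · rw [WithTop.coe_lt_coe]
      obtain ⟨ε, hε, hball⟩ : ∃ u > t, ∀ s ∈ Set.Ioo t u, X s ω = X t ω := by
        have := hX.rightContinuous ω t
        obtain ⟨u, hu, hsub⟩ := (mem_nhdsGT_iff_exists_Ioo_subset).1 this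
        exact ⟨u, hu, fun s hs => hsub hs⟩
      refine lt_of_lt_of_le hε (le_csInf hex ?_)
      rintro s ⟨-, hs⟩
      by_contra hlt
      push Not at hlt
      rcases le_or_gt s t with hst | hst
      · exact h s hst hs
      · exact h t le_rfl (hball s ⟨hst, hlt⟩ ▸ hs)
    · exact WithTop.coe_lt_top t

/-- A visit at s < t lasts until some u > s, so it is seen at a dyadic fraction of t. -/
lemma exists_dyadic_mem {s t u : ℝ≥0} (hst : s < t) (hsu : s < u) :
    ∃ m k : ℕ, k ≤ 2 ^ m ∧ s < k * (t / 2 ^ m) ∧ (k : ℝ≥0) * (t / 2 ^ m) < u := by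
  have ht : 0 < t := lt_of_le_of_lt zero_le hst
  set v := min t u
  have hv : s < v := lt_min hst hsu
  obtain ⟨m, hm⟩ : ∃ m : ℕ, t / 2 ^ m < v - s := by
    have h1 : 0 < (v - s) / t := div_pos (tsub_pos_of_lt hv) ht
    obtain ⟨m, hm⟩ := exists_pow_lt_of_lt_one h1 (show (1 / 2 : ℝ≥0) < 1 by
      rw [← NNReal.coe_lt_coe]; norm_num)
    refine ⟨m, ?_⟩
    rw [lt_div_iff₀ ht] at hm
    calc t / 2 ^ m = (1 / 2) ^ m * t := by rw [one_div, inv_pow]; field_simp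
      _ < _ := hm
  set δ := t / 2 ^ m with hδ
  have hδ0 : 0 < δ := by positivity
  have htδ : (2 ^ m : ℝ≥0) * δ = t := by rw [hδ]; field_simp
  set k := ⌊s / δ⌋₊ + 1 with hk
  have h1 : s < k * δ := by
    have := Nat.lt_floor_add_one (s / δ)
    rw [div_lt_iff₀ hδ0] at this
    simpa [hk] using this
  have h2 : (k : ℝ≥0) * δ < v := by
    have := Nat.floor_le (show 0 ≤ s / δ from zero_le)
    rw [le_div_iff₀ hδ0] at this
    calc (k : ℝ≥0) * δ = ⌊s / δ⌋₊ * δ + δ := by rw [hk]; push_cast; ring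
      _ < s + (v - s) := add_lt_add_of_le_of_lt this hm
      _ = v := add_tsub_cancel_of_le hv.le
  refine ⟨m, k, ?_, h1, lt_of_lt_of_le h2 (min_le_right _ _)⟩
  have h3 : (k : ℝ≥0) * δ < (2 ^ m : ℝ≥0) * δ := by
    rw [htδ]; exact lt_of_lt_of_le h2 (min_le_left _ _)
  have h4 := lt_of_mul_lt_mul_right h3 zero_le
  exact_mod_cast h4.le

/-- Every set of dominated states is a halting set. -/
theorem IsMarkovChain.isHaltingSet_of_subset_dominatedStates (hX : IsMarkovChain P Q ν X)
    (hQ : ∀ i j, i ≠ j → 0 ≤ Q i j) {π : S → ℝ} (hπ : IsStationary Q π) {A : Set S}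
    (hA : A ⊆ dominatedStates P X π) : IsHaltingSet P X π A := by
  intro t
  -- Dyadic grids are nested, so these events decrease, and avoiding A on all of them forces T_A >
  -- t. Grid bounds pass to the limit by continuity from above.
  let G : ℕ → Set Ω := fun m => {ω | ∀ k ≤ 2 ^ m, X ((k : ℕ) * (t / 2 ^ m)) ω ∉ A}
  have hanti : Antitone G := by
    refine antitone_nat_of_succ_le fun m ω hω k hk => ?_
    have := hω (2 * k) (by rw [pow_succ]; omega)
    convert! this using 3
    push_cast
    rw [pow_succ]
    field_simp
  have hmeas : ∀ m, MeasurableSet (G m) := by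
    intro m
    have : G m = ⋂ k ∈ Finset.range (2 ^ m + 1), ⋂ a ∈ (Finset.univ : Finset S), ⋂ (_ : a ∈ A),
        {ω | X ((k : ℕ) * (t / 2 ^ m)) ω = a}ᶜ := by
      ext ω
      simp only [G, Set.mem_ofPred_eq, Set.mem_iInter, Finset.mem_range, Set.mem_compl_iff,
        Nat.lt_succ_iff, Finset.mem_univ, true_imp_iff]
      exact ⟨fun h k hk a ha he => h k hk (he ▸ ha), fun h k hk hm => h k hk _ hm rfl⟩
    rw [this]
    exact Finset.measurableSet_biInter _ fun k _ => Finset.measurableSet_biInter _ fun a _ =>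
      MeasurableSet.iInter fun _ => (hX.measurable _ _).compl
  have hsub : (⋂ m, G m) ⊆ {ω | (t : WithTop ℝ≥0) < hittingAfter X A 0 ω} := by
    intro ω hω
    rw [Set.mem_ofPred_eq, hX.lt_hittingAfter_iff]
    intro s hs hmem
    rw [Set.mem_iInter] at hω
    rcases hs.lt_or_eq with hlt | rfl
    · obtain ⟨u, hu, hsu⟩ := (mem_nhdsGT_iff_exists_Ioo_subset).1 (hX.rightContinuous ω s)
      obtain ⟨m, k, hk, h1, h2⟩ := exists_dyadic_mem hlt hu
      have h3 : X ((k : ℕ) * (t / 2 ^ m)) ω = X s ω := hsu ⟨h1, h2⟩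
      exact hω m k hk (h3 ▸ hmem)
    · have := hω 0 1 (by norm_num)
      simp only [Nat.cast_one, pow_zero, div_one, one_mul] at this
      exact this hmem
  have hlim := tendsto_measure_iInter_atTop (μ := P) (fun m => (hmeas m).nullMeasurableSet) hanti
    ⟨0, measure_ne_top _ _⟩
  have hlim' : Tendsto (fun m => P.real (G m)) atTop (𝓝 (P.real (⋂ m, G m))) :=
    (ENNReal.tendsto_toReal (measure_ne_top _ _)).comp hlim
  refine (ge_of_tendsto' hlim' fun m => ?_).trans (measureReal_mono hsub)
  have := hX.dist_le_grid hQ hπ hA (t / 2 ^ m) (2 ^ m)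
  rw [show ((2 ^ m : ℕ) : ℝ≥0) * (t / 2 ^ m) = t by push_cast; field_simp] at this
  exact this

lemma IsMarkovChain.isHaltingState_of_isHaltingSet (hX : IsMarkovChain P Q ν X) {π : S → ℝ}
    {A : Set S} {x : S} (hx : x ∈ A) (hA : IsHaltingSet P X π A) : IsHaltingState P X π x := by
  intro t
  refine (hA t).trans (measureReal_mono fun ω hω => ?_)
  rw [Set.mem_ofPred_eq, hX.lt_hittingAfter_iff] at hω ⊢
  intro s hs h
  rw [Set.mem_singleton_iff] at h
  exact hω s hs (h ▸ hx)

/-- Exponential decay of the hitting time tail of the boundary state `x` of `A`, from a Lyapunov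
function `g` for the chain killed on `A`. -/
theorem IsMarkovChain.measureReal_lt_hittingAfter_le (hX : IsMarkovChain P Q ν X)
    (hQ : ∀ i j, i ≠ j → 0 ≤ Q i j) {A : Set S} {x : S}
    (hskip : ∀ i ∉ A, ∀ j ∈ A, j ≠ x → Q i j = 0)
    (hstart : ∀ j ∈ A, law P X 0 j = 0) {g : S → ℝ} (hg0 : ∀ i ∈ A, g i = 0)
    (hg1 : ∀ i ∉ A, 1 ≤ g i) {γ : ℝ} (hγ : ∀ i ∉ A, (Q *ᵥ g) i < -γ * g i) (t : ℝ≥0) :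
    P.real {ω | (t : WithTop ℝ≥0) < hittingAfter X {x} 0 ω}
      ≤ Real.exp (-γ * t) * ∑ i, law P X 0 i * g i := by
  classical
  have hg : ∀ i, 0 ≤ g i := fun i => by
    by_cases hi : i ∈ A
    · exact (hg0 i hi).ge
    · linarith [hg1 i hi]
  -- The strict drift inequality compares derivatives at h = 0, so the contraction holds for all
  -- small h > 0.
  have hcontr : ∀ᶠ h : ℝ in 𝓝[>] 0, ∀ i ∉ A,
      (NormedSpace.exp (h • Q) *ᵥ g) i ≤ Real.exp (-γ * h) * g i := by
    rw [eventually_all]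
    intro i
    by_cases hi : i ∈ A
    · exact Eventually.of_forall fun h hn => absurd hi hn
    have hd : HasDerivAt (fun h : ℝ => Real.exp (-γ * h) * g i - (NormedSpace.exp (h • Q) *ᵥ g) i)
        (-γ * g i - (Q *ᵥ g) i) 0 := by
      have h1 : HasDerivAt (fun h : ℝ => Real.exp (-γ * h) * g i) (-γ * g i) 0 := by
        have := (((hasDerivAt_id (0 : ℝ)).const_mul (-γ)).exp).mul_const (g i)
        simpa using! this
      have h2 := HasDerivAt.fun_sum (u := Finset.univ) fun j _ =>
        (hasDerivAt_exp_smul_apply Q i j 0).mul_const (g j)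
      simp only [zero_smul, NormedSpace.exp_zero, mul_one] at h2
      exact h1.sub h2
    have hpos := sub_pos.2 (hγ i hi)
    have hs := (hasDerivAt_iff_tendsto_slope_zero.1 hd).mono_left
      (nhdsWithin_mono 0 (fun y (hy : (0 : ℝ) < y) => hy.ne' : Set.Ioi (0 : ℝ) ⊆ {0}ᶜ))
    filter_upwards [hs.eventually_const_lt hpos, self_mem_nhdsWithin] with h hh hh0 _
    simp only [zero_add, mul_zero, Real.exp_zero, one_mul, zero_smul, NormedSpace.exp_zero,
      Matrix.one_mulVec, sub_self, sub_zero, smul_eq_mul] at hh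
    have := pos_of_mul_pos_right hh (inv_pos.2 hh0).le
    linarith
  have hstep : ∀ (h : ℝ≥0), (∀ i ∉ A,
      (NormedSpace.exp ((h : ℝ) • Q) *ᵥ g) i ≤ Real.exp (-γ * h) * g i) → ∀ n : ℕ,
      ∑ y, gridAvoid P X A h n y * g y ≤ Real.exp (-γ * h) ^ n * ∑ i, law P X 0 i * g i := by
    intro h hh n
    induction n with
    | zero =>
      rw [pow_zero, one_mul]
      refine Finset.sum_le_sum fun y _ => mul_le_mul_of_nonneg_right ?_ (hg y)
      refine measureReal_mono ?_
      rintro ω ⟨-, hω⟩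
      simpa using hω
    | succ n ih =>
      calc ∑ y, gridAvoid P X A h (n + 1) y * g y
          = ∑ y, ∑ z, gridAvoid P X A h n z * (NormedSpace.exp ((h : ℝ) • Q) z y * g y) := by
            refine Finset.sum_congr rfl fun y _ => ?_
            by_cases hy : y ∈ A
            · simp [hg0 y hy]
            · rw [hX.gridAvoid_succ A h n hy, Finset.sum_mul]
              exact Finset.sum_congr rfl fun z _ => mul_assoc _ _ _
        _ = ∑ z, gridAvoid P X A h n z * (NormedSpace.exp ((h : ℝ) • Q) *ᵥ g) z := by
            rw [Finset.sum_comm]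
            exact Finset.sum_congr rfl fun z _ => (Finset.mul_sum _ _ _).symm
        _ ≤ ∑ z, gridAvoid P X A h n z * (Real.exp (-γ * h) * g z) := by
            refine Finset.sum_le_sum fun z _ => ?_
            by_cases hz : z ∈ A
            · simp [gridAvoid_of_mem h n hz]
            · exact mul_le_mul_of_nonneg_left (hh z hz) (gridAvoid_nonneg A h n z)
        _ = Real.exp (-γ * h) * ∑ z, gridAvoid P X A h n z * g z := by
            rw [Finset.mul_sum]
            exact Finset.sum_congr rfl fun z _ => by ring
        _ ≤ _ := by
            rw [pow_succ', mul_assoc]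
            exact mul_le_mul_of_nonneg_left ih (Real.exp_pos _).le
  -- Grid steps that enter A without landing on x. Their rates vanish, so each has probability o(h).
  set B : Finset (S × S) := Finset.univ.filter fun q => q.1 ∉ A ∧ q.2 ∈ A ∧ q.2 ≠ x with hB
  have hskipProb : ∀ (h : ℝ≥0) (n : ℕ), P.real {ω | ∀ k ≤ n, X ((k : ℕ) * h) ω ≠ x} ≤
      ∑ y, gridAvoid P X A h n y * g y
        + n * ∑ q ∈ B, NormedSpace.exp ((h : ℝ) • Q) q.1 q.2 := by
    intro h n
    -- A path missing x on the grid avoids A, first enters A through a pair in B, or starts in A.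
    have hsub : {ω | ∀ k ≤ n, X ((k : ℕ) * h) ω ≠ x} ⊆
        ({ω | ∀ k ≤ n, X ((k : ℕ) * h) ω ∉ A} ∪
          ⋃ r ∈ Finset.range n ×ˢ B, {ω | X ((r.1 : ℕ) * h) ω = r.2.1} ∩
            {ω | X ((r.1 + 1 : ℕ) * h) ω = r.2.2}) ∪
          ⋃ j ∈ Finset.univ.filter (· ∈ A), {ω | X 0 ω = j} := by
      intro ω hω
      by_cases hall : ∀ k ≤ n, X ((k : ℕ) * h) ω ∉ A
      · exact Or.inl (Or.inl hall)
      push Not at hall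
      set k := Nat.find hall with hk
      obtain ⟨hkn, hkA⟩ := Nat.find_spec hall
      rcases Nat.eq_zero_or_pos k with h0 | hpos
      · right
        rw [← hk, h0] at hkA
        simp only [Nat.cast_zero, zero_mul] at hkA
        exact Set.mem_biUnion (x := X 0 ω) (by simpa using hkA) rfl
      · left; right
        have hprev : X ((k - 1 : ℕ) * h) ω ∉ A := by
          intro hc
          exact Nat.find_min hall (show k - 1 < Nat.find hall by omega) ⟨by omega, hc⟩
        refine Set.mem_biUnion (x := (k - 1, X ((k - 1 : ℕ) * h) ω, X ((k : ℕ) * h) ω)) ?_ ?_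
        · simp only [Finset.coe_product, Set.mem_prod, Finset.mem_coe, Finset.mem_range, hB,
            Finset.mem_filter, Finset.mem_univ, true_and]
          exact ⟨by omega, hprev, hkA, hω k hkn⟩
        · refine ⟨rfl, ?_⟩
          rw [Set.mem_ofPred_eq, Nat.sub_add_cancel hpos]
    have h1 : P.real {ω | ∀ k ≤ n, X ((k : ℕ) * h) ω ∉ A} ≤ ∑ y, gridAvoid P X A h n y * g y := by
      rw [← hX.sum_gridAvoid]
      refine Finset.sum_le_sum fun y _ => ?_
      by_cases hy : y ∈ A
      · simp [gridAvoid_of_mem h n hy]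
      · exact le_mul_of_one_le_right (gridAvoid_nonneg A h n y) (hg1 y hy)
    have h2 : P.real (⋃ r ∈ Finset.range n ×ˢ B, {ω | X ((r.1 : ℕ) * h) ω = r.2.1} ∩
        {ω | X ((r.1 + 1 : ℕ) * h) ω = r.2.2})
          ≤ n * ∑ q ∈ B, NormedSpace.exp ((h : ℝ) • Q) q.1 q.2 := by
      refine (measureReal_biUnion_finset_le _ _).trans ?_
      calc _ ≤ ∑ r ∈ Finset.range n ×ˢ B, NormedSpace.exp ((h : ℝ) • Q) r.2.1 r.2.2 := by
            refine Finset.sum_le_sum fun r _ => ?_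
            have := hX.measureReal_step (grid_monotone h) r.1 (F := Set.univ)
              (fun _ _ _ _ => trivial) r.2.1 r.2.2
            rw [grid_sub] at this
            simp only [Set.univ_inter] at this
            rw [this]
            exact mul_le_of_le_one_left (exp_smul_nonneg hQ h.2 _ _) measureReal_le_one
        _ = _ := by
            rw [Finset.sum_product]
            simp
    have h3 : P.real (⋃ j ∈ Finset.univ.filter (· ∈ A), {ω | X 0 ω = j}) ≤ 0 := by
      refine (measureReal_biUnion_finset_le _ _).trans (le_of_eq ?_)
      exact Finset.sum_eq_zero fun j hj => hstart j (by simpa using hj)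
    have h4 := (measureReal_mono (μ := P) hsub).trans (measureReal_union_le _ _)
    have h5 := measureReal_union_le (μ := P) {ω | ∀ k ≤ n, X ((k : ℕ) * h) ω ∉ A}
      (⋃ r ∈ Finset.range n ×ˢ B, {ω | X ((r.1 : ℕ) * h) ω = r.2.1} ∩
            {ω | X ((r.1 + 1 : ℕ) * h) ω = r.2.2})
    linarith
  have hlim : Tendsto (fun n : ℕ => (n : ℝ) *
      ∑ q ∈ B, NormedSpace.exp (((t / n : ℝ≥0) : ℝ) • Q) q.1 q.2) atTop (𝓝 0) := by
    simp only [Finset.mul_sum]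
    rw [show (0 : ℝ) = ∑ q ∈ B, (0 : ℝ) by simp]
    refine tendsto_finsetSum _ fun q hq => ?_
    obtain ⟨hq1, hq2, hq3⟩ := (Finset.mem_filter.1 hq).2
    have hd : HasDerivAt (fun u : ℝ => NormedSpace.exp (((t : ℝ) * u) • Q) q.1 q.2) 0 0 := by
      have h1 := hasDerivAt_exp_smul_apply Q q.1 q.2 ((t : ℝ) * 0)
      have h2 := h1.comp 0 ((hasDerivAt_id (0 : ℝ)).const_mul (t : ℝ))
      simpa [Function.comp_def, hskip q.1 hq1 q.2 hq2 hq3] using! h2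
    have hs := hasDerivAt_iff_tendsto_slope_zero.1 hd
    have hinv : Tendsto (fun n : ℕ => ((n : ℝ))⁻¹) atTop (𝓝[≠] 0) :=
      (tendsto_inv_atTop_nhdsGT_zero.mono_right
        (nhdsWithin_mono 0 fun y (hy : (0 : ℝ) < y) => hy.ne')).comp tendsto_natCast_atTop_atTop
    have h3 := hs.comp hinv
    have hne : q.1 ≠ q.2 := fun h => hq1 (h ▸ hq2)
    simpa [Function.comp_def, Matrix.one_apply_ne hne, div_eq_mul_inv] using! h3
  have hgrid : Tendsto (fun n : ℕ => ((t / n : ℝ≥0) : ℝ)) atTop (𝓝[≥] 0) := by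
    refine tendsto_nhdsWithin_iff.2 ⟨?_, Eventually.of_forall fun n => (t / n : ℝ≥0).2⟩
    push_cast
    exact tendsto_const_div_atTop_nhds_zero_nat _
  -- Step zero is included because t may be 0.
  have hcontr' : ∀ᶠ h : ℝ in 𝓝[≥] 0, ∀ i ∉ A,
      (NormedSpace.exp (h • Q) *ᵥ g) i ≤ Real.exp (-γ * h) * g i := by
    rw [← Set.Ioi_insert, nhdsWithin_insert, eventually_sup]
    refine ⟨?_, hcontr⟩
    simp
  refine ge_of_tendsto (x := atTop) (f := fun n : ℕ =>
    Real.exp (-γ * t) * ∑ i, law P X 0 i * g i + (n : ℝ) *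
      ∑ q ∈ B, NormedSpace.exp (((t / n : ℝ≥0) : ℝ) • Q) q.1 q.2) ?_ ?_
  · simpa using hlim.const_add (Real.exp (-γ * t) * ∑ i, law P X 0 i * g i)
  · filter_upwards [hgrid.eventually hcontr', eventually_gt_atTop 0] with n hn hn0
    have hn1 : (n : ℝ≥0) ≠ 0 := by exact_mod_cast hn0.ne'
    have h1 := hstep (t / n) hn n
    have h2 := hskipProb (t / n) n
    have h3 : Real.exp (-γ * ((t / n : ℝ≥0) : ℝ)) ^ n = Real.exp (-γ * t) := by
      rw [← Real.exp_nat_mul]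
      congr 1
      push_cast
      have : (n : ℝ) ≠ 0 := by exact_mod_cast hn0.ne'
      field_simp
    rw [h3] at h1
    refine le_trans (measureReal_mono fun ω hω => ?_) (h2.trans (by linarith))
    rw [Set.mem_ofPred_eq, hX.lt_hittingAfter_iff] at hω
    intro k hk
    refine fun hc => hω ((k : ℕ) * (t / n)) ?_ hc
    calc (k : ℝ≥0) * (t / n) ≤ n * (t / n) := by gcongr
      _ = t := by field_simp

end Paths

end EhrenfestCutoff
namespace EhrenfestCutoff

/-! ### Binomial weights and their fluxes. -/

section Binomial

/-- The binomial probabilities with `N` trials and success probability `s`. -/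
noncomputable def binomialWeight (N : ℕ) (s : ℝ) (k : ℕ) : ℝ :=
  N.choose k * s ^ k * (1 - s) ^ (N - k)

lemma eval_bernsteinPolynomial (N k : ℕ) (s : ℝ) :
    (bernsteinPolynomial ℝ N k).eval s = binomialWeight N s k := by
  simp [bernsteinPolynomial, binomialWeight]

lemma binomialWeight_succ_self (N : ℕ) (s : ℝ) : binomialWeight N s (N + 1) = 0 := by
  simp [binomialWeight]

lemma binomialWeight_nonneg {s : ℝ} (h0 : 0 ≤ s) (h1 : s ≤ 1) (N k : ℕ) :
    0 ≤ binomialWeight N s k := by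
  have : 0 ≤ 1 - s := by linarith
  rw [binomialWeight]; positivity

lemma binomialWeight_pos {s : ℝ} (h0 : 0 < s) (h1 : s < 1) {N k : ℕ} (hk : k ≤ N) :
    0 < binomialWeight N s k := by
  have : 0 < 1 - s := by linarith
  have := Nat.choose_pos hk
  rw [binomialWeight]; positivity

lemma sum_binomialWeight (N : ℕ) (s : ℝ) : ∑ k : Fin (N + 1), binomialWeight N s k = 1 := by
  rw [Fin.sum_univ_eq_sum_range (fun k => binomialWeight N s k)]
  have := congrArg (Polynomial.eval s) (bernsteinPolynomial.sum ℝ N)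
  simpa [Polynomial.eval_finsetSum, eval_bernsteinPolynomial] using this

lemma sum_mul_binomialWeight (N : ℕ) (s : ℝ) :
    ∑ k : Fin (N + 1), ((k : ℕ) : ℝ) * binomialWeight N s k = N * s := by
  rw [Fin.sum_univ_eq_sum_range (fun k => (k : ℝ) * binomialWeight N s k)]
  have := congrArg (Polynomial.eval s) (bernsteinPolynomial.sum_smul ℝ N)
  simpa [Polynomial.eval_finsetSum, eval_bernsteinPolynomial] using this

lemma sum_sq_mul_binomialWeight (N : ℕ) (s : ℝ) :
    ∑ k : Fin (N + 1), (N * s - ((k : ℕ) : ℝ)) ^ 2 * binomialWeight N s k = N * s * (1 - s) := by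
  rw [Fin.sum_univ_eq_sum_range (fun k => (N * s - (k : ℝ)) ^ 2 * binomialWeight N s k)]
  have := congrArg (Polynomial.eval s) (bernsteinPolynomial.variance ℝ N)
  simpa [Polynomial.eval_finsetSum, eval_bernsteinPolynomial] using this

/-- `N` times the binomial probability of `k` with `N - 1` trials. -/
noncomputable def binomialFlux (N : ℕ) (s : ℝ) (k : ℕ) : ℝ :=
  (N - k) * (N.choose k * s ^ k * (1 - s) ^ (N - 1 - k))

/-- With `succ_mul_binomialWeight`, this expresses the upward and downward flows across the edge (k,
k+1) through one common flux. -/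
lemma sub_mul_binomialWeight {N k : ℕ} (hk : k ≤ N) (s : ℝ) :
    (N - k) * binomialWeight N s k = (1 - s) * binomialFlux N s k := by
  rcases hk.lt_or_eq with h | rfl
  · rw [binomialWeight, binomialFlux, show N - k = (N - 1 - k) + 1 by omega, pow_succ]
    ring
  · simp [binomialFlux]

lemma succ_mul_choose {N k : ℕ} (hk : k ≤ N) :
    ((k : ℝ) + 1) * N.choose (k + 1) = (N - k) * N.choose k := by
  have := Nat.choose_succ_right_eq N k
  have h2 : ((N.choose (k + 1) * (k + 1) : ℕ) : ℝ) = (N.choose k * (N - k) : ℕ) := by rw [this]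
  push_cast [Nat.cast_sub hk] at h2
  linarith

lemma succ_mul_binomialWeight {N k : ℕ} (hk : k ≤ N) (s : ℝ) :
    ((k : ℝ) + 1) * binomialWeight N s (k + 1) = s * binomialFlux N s k := by
  rw [binomialWeight, binomialFlux, show N - (k + 1) = N - 1 - k by omega]
  linear_combination (s ^ (k + 1) * (1 - s) ^ (N - 1 - k)) * succ_mul_choose hk

/-- This discrete divergence of the flux has the same shape as the generator's action, which is why
binomials stay binomial. -/
lemma hasDerivAt_binomialWeight {N k : ℕ} (hk : k ≤ N) (s : ℝ) :
    HasDerivAt (fun u => binomialWeight N u k)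
      ((if k = 0 then 0 else binomialFlux N s (k - 1)) - binomialFlux N s k) s := by
  have h1 := (hasDerivAt_pow k s).const_mul (N.choose k : ℝ)
  have h2 := ((hasDerivAt_id s).const_sub 1).pow (N - k)
  have h3 := h1.mul h2
  convert! h3 using 1
  simp only [id, Pi.pow_apply]
  rcases k with _ | m
  · simp [binomialFlux]
  · have := succ_mul_choose (show m ≤ N by omega)
    rw [if_neg (Nat.succ_ne_zero m), Nat.add_sub_cancel, binomialFlux, binomialFlux,
      show N - (m + 1) = N - 1 - m by omega, show N - 1 - m - 1 = N - 1 - (m + 1) by omega,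
      show ((N - 1 - m : ℕ) : ℝ) = N - (m + 1) by
        rw [show N - 1 - m = N - (m + 1) by omega, Nat.cast_sub hk]; push_cast; ring]
    push_cast
    linear_combination (-s ^ m * (1 - s) ^ (N - 1 - m)) * this

end Binomial

/-! ### Comparing two binomial laws. -/

section Comparison

variable {N k : ℕ} {s p : ℝ}

/-- Apply 1 + u ≤ e^u to the ratios p/s and (1-p)/(1-s). The exponents add up to
(p-s)(k-Ns)/(s(1-s)), so moving the parameter away from k/N lowers the likelihood. -/
lemma pow_mul_pow_le_of_mean (hs0 : 0 < s) (hs1 : s < 1) (hp0 : 0 ≤ p) (hp1 : p ≤ 1) (hk : k ≤ N)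
    (h : (p - s) * (k - N * s) ≤ 0) :
    p ^ k * (1 - p) ^ (N - k) ≤ s ^ k * (1 - s) ^ (N - k) := by
  have hs1' : 0 < 1 - s := by linarith
  have e1 : p / s ≤ Real.exp (p / s - 1) := by linarith [Real.add_one_le_exp (p / s - 1)]
  have e2 : (1 - p) / (1 - s) ≤ Real.exp ((1 - p) / (1 - s) - 1) := by
    linarith [Real.add_one_le_exp ((1 - p) / (1 - s) - 1)]
  have e3 : (p / s) ^ k * ((1 - p) / (1 - s)) ^ (N - k) ≤ 1 := by
    calc (p / s) ^ k * ((1 - p) / (1 - s)) ^ (N - k)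
        ≤ Real.exp (p / s - 1) ^ k * Real.exp ((1 - p) / (1 - s) - 1) ^ (N - k) := by
          have : 0 ≤ (1 - p) / (1 - s) := div_nonneg (by linarith) hs1'.le
          gcongr
      _ = Real.exp ((p - s) * (k - N * s) / (s * (1 - s))) := by
          rw [← Real.exp_nat_mul, ← Real.exp_nat_mul, ← Real.exp_add, Nat.cast_sub hk]
          congr 1
          field_simp
          ring
      _ ≤ 1 := Real.exp_le_one_iff.2 (div_nonpos_of_nonpos_of_nonneg h (by positivity))
  rw [div_pow, div_pow, div_mul_div_comm, div_le_one (by positivity)] at e3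
  exact e3

lemma binomialWeight_le_of_mean_le (hp0 : 0 < p) (hp1 : p < 1) (hs0 : 0 ≤ s) (hsp : s ≤ p)
    (hk : k ≤ N) (h : N * p ≤ k) : binomialWeight N s k ≤ binomialWeight N p k := by
  rw [binomialWeight, binomialWeight, mul_assoc, mul_assoc]
  exact mul_le_mul_of_nonneg_left (pow_mul_pow_le_of_mean hp0 hp1 hs0 (by linarith) hk
    (mul_nonpos_of_nonpos_of_nonneg (by linarith) (by linarith))) (by positivity)

/-- The likelihood of `k` is strictly largest at success probability `k / N`. -/
lemma binomialWeight_lt_of_lt_mean (hp1 : p < 1) (hN : 0 < N) (h : (k : ℝ) < N * p) :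
    binomialWeight N p k < binomialWeight N (k / N) k := by
  have hN' : (0 : ℝ) < N := by exact_mod_cast hN
  have hp0 : 0 < p := by
    by_contra hc
    have : (N : ℝ) * p ≤ 0 := mul_nonpos_of_nonneg_of_nonpos hN'.le (by linarith)
    linarith [(Nat.cast_nonneg k : (0 : ℝ) ≤ k)]
  have hk : k ≤ N := by
    have : (k : ℝ) < N := lt_of_lt_of_le h (mul_le_of_le_one_right hN'.le hp1.le)
    exact_mod_cast this.le
  rcases Nat.eq_zero_or_pos k with rfl | hk0
  · simp only [binomialWeight, Nat.choose_zero_right, Nat.cast_one, pow_zero, one_mul, Nat.sub_zero,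
      Nat.cast_zero, zero_div, sub_zero, one_pow]
    exact pow_lt_one₀ (by linarith) (by linarith) hN.ne'
  have hk0' : (0 : ℝ) < k := by exact_mod_cast hk0
  set s : ℝ := k / N with hs
  have hNs : N * s = k := by rw [hs]; field_simp
  have hs0 : 0 < s := by positivity
  have hsp : s < p := by rw [hs, div_lt_iff₀ hN']; linarith
  clear_value s
  have hc : (0 : ℝ) < N.choose k := by exact_mod_cast Nat.choose_pos hk
  -- As p ≠ s and k > 0, the first exponential bound is strict, while the total exponent is 0
  -- because Ns = k.
  have e1 : p / s - 1 ≠ 0 := by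
    rw [sub_ne_zero, ne_eq, div_eq_one_iff_eq hs0.ne']; exact hsp.ne'
  have hs1' : 0 < 1 - s := by linarith
  have e1' : p / s < Real.exp (p / s - 1) := by linarith [Real.add_one_lt_exp e1]
  have e2 : (1 - p) / (1 - s) ≤ Real.exp ((1 - p) / (1 - s) - 1) := by
    linarith [Real.add_one_le_exp ((1 - p) / (1 - s) - 1)]
  have hpos : 0 < (1 - p) / (1 - s) := div_pos (by linarith) hs1'
  have e3 : (p / s) ^ k * ((1 - p) / (1 - s)) ^ (N - k) < 1 := by
    calc (p / s) ^ k * ((1 - p) / (1 - s)) ^ (N - k)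
        < Real.exp (p / s - 1) ^ k * Real.exp ((1 - p) / (1 - s) - 1) ^ (N - k) :=
          mul_lt_mul (pow_lt_pow_left₀ e1' (by positivity) hk0.ne')
            (pow_le_pow_left₀ hpos.le e2 _) (pow_pos hpos _) (by positivity)
      _ = Real.exp ((p - s) * (k - N * s) / (s * (1 - s))) := by
          rw [← Real.exp_nat_mul, ← Real.exp_nat_mul, ← Real.exp_add, Nat.cast_sub hk]
          congr 1
          field_simp
          ring
      _ = 1 := by rw [hNs]; simp
  rw [div_pow, div_pow, div_mul_div_comm, div_lt_one (by positivity)] at e3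
  rw [binomialWeight, binomialWeight, mul_assoc, mul_assoc]
  exact mul_lt_mul_of_pos_left e3 hc

/-- Second moment method: lower bound for the total variation distance of two binomial laws. -/
lemma one_sub_le_tvDist_binomial (hs0 : 0 ≤ s) (hs1 : s ≤ 1) (hsp : s < p) (hp1 : p ≤ 1)
    (hN : 0 < N) :
    1 - 2 / (N * (p - s) ^ 2) ≤ tvDist (fun k : Fin (N + 1) => binomialWeight N s k)
      (fun k => binomialWeight N p k) := by
  have hN' : (0 : ℝ) < N := by exact_mod_cast hN
  -- The midpoint of the two means separates the laws; each side is at distance √D from the other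
  -- side's mean.
  set m : ℝ := N * (s + p) / 2 with hm
  set D : ℝ := (N * (p - s) / 2) ^ 2 with hD
  have hDpos : 0 < D := by
    have : 0 < p - s := by linarith
    positivity
  set A : Finset (Fin (N + 1)) := Finset.univ.filter fun k => ((k : ℕ) : ℝ) ≤ m with hA
  have hvar : ∀ u : ℝ, N * u * (1 - u) ≤ N / 4 := fun u => by nlinarith [sq_nonneg (2 * u - 1)]
  have chebyshev : ∀ u : ℝ, 0 ≤ u → u ≤ 1 → ∀ B : Finset (Fin (N + 1)),
      (∀ k ∈ B, D ≤ (N * u - ((k : ℕ) : ℝ)) ^ 2) → ∑ k ∈ B, binomialWeight N u k ≤ N / 4 / D := by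
    intro u hu0 hu1 B hB
    rw [le_div_iff₀ hDpos, Finset.sum_mul]
    calc ∑ k ∈ B, binomialWeight N u k * D
        ≤ ∑ k ∈ B, (N * u - ((k : ℕ) : ℝ)) ^ 2 * binomialWeight N u k := by
          refine Finset.sum_le_sum fun k hk => ?_
          rw [mul_comm]
          exact mul_le_mul_of_nonneg_right (hB k hk) (binomialWeight_nonneg hu0 hu1 N k)
      _ ≤ ∑ k : Fin (N + 1), (N * u - ((k : ℕ) : ℝ)) ^ 2 * binomialWeight N u k :=
          Finset.sum_le_sum_of_subset_of_nonneg (Finset.subset_univ _) fun k _ _ =>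
            mul_nonneg (sq_nonneg _) (binomialWeight_nonneg hu0 hu1 N k)
      _ ≤ N / 4 := by rw [sum_sq_mul_binomialWeight]; exact hvar u
  have hp : ∑ k ∈ A, binomialWeight N p k ≤ N / 4 / D := by
    refine chebyshev p (by linarith) hp1 A fun k hk => ?_
    have hk' : ((k : ℕ) : ℝ) ≤ m := by simpa [hA] using hk
    refine pow_le_pow_left₀ (by have : 0 < p - s := by linarith
                                positivity) ?_ 2
    linarith
  have hs : ∑ k ∈ Aᶜ, binomialWeight N s k ≤ N / 4 / D := by
    refine chebyshev s hs0 hs1 Aᶜ fun k hk => ?_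
    have hk' : m < ((k : ℕ) : ℝ) := by simpa [hA] using hk
    rw [← neg_sq (N * s - ((k : ℕ) : ℝ))]
    refine pow_le_pow_left₀ (by have : 0 < p - s := by linarith
                                positivity) ?_ 2
    linarith
  have h1 := le_tvDist (sum_binomialWeight N s) (sum_binomialWeight N p) A
  have h2 := Finset.sum_add_sum_compl A fun k => binomialWeight N s k
  rw [sum_binomialWeight] at h2
  have h3 : (N : ℝ) / 4 / D = 1 / (N * (p - s) ^ 2) := by
    have : p - s ≠ 0 := by linarith
    rw [hD]; field_simp; norm_num
  rw [h3] at hp hs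
  have h4 : 2 / (N * (p - s) ^ 2) = 1 / (N * (p - s) ^ 2) + 1 / (N * (p - s) ^ 2) := by ring
  linarith

/-- The chi-square bound for the total variation distance of two binomial laws. -/
lemma tvDist_binomial_le (hp0 : 0 < p) (hp1 : p < 1) :
    tvDist (fun k : Fin (N + 1) => binomialWeight N s k) (fun k => binomialWeight N p k)
      ≤ √(Real.exp (N * (p - s) ^ 2 / (p * (1 - p))) - 1) := by
  have hp1' : 0 < 1 - p := by linarith
  have hpos : ∀ k : Fin (N + 1), 0 < binomialWeight N p k := fun k =>
    binomialWeight_pos hp0 hp1 (by omega)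
  -- The second moment of the likelihood ratio is the N-th power of its single-trial value.
  have hchi : ∑ k : Fin (N + 1), (binomialWeight N s k) ^ 2 / binomialWeight N p k
      = (s ^ 2 / p + (1 - s) ^ 2 / (1 - p)) ^ N := by
    rw [Fin.sum_univ_eq_sum_range (fun k => (binomialWeight N s k) ^ 2 / binomialWeight N p k),
      add_pow]
    refine Finset.sum_congr rfl fun k hk => ?_
    have hc : (N.choose k : ℝ) ≠ 0 := by
      exact_mod_cast (Nat.choose_pos (by simpa [Nat.lt_succ_iff] using hk)).ne'
    obtain ⟨q, hq⟩ : ∃ q, q = 1 - s := ⟨_, rfl⟩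
    rw [binomialWeight, binomialWeight, div_pow, div_pow, ← hq]
    field_simp
    ring
  have hbase : s ^ 2 / p + (1 - s) ^ 2 / (1 - p) = 1 + (p - s) ^ 2 / (p * (1 - p)) := by
    field_simp; ring
  have hsum : ∑ k : Fin (N + 1), (binomialWeight N s k - binomialWeight N p k) ^ 2
      / binomialWeight N p k ≤ Real.exp (N * (p - s) ^ 2 / (p * (1 - p))) - 1 := by
    have h1 : ∀ k : Fin (N + 1), (binomialWeight N s k - binomialWeight N p k) ^ 2
        / binomialWeight N p k = (binomialWeight N s k) ^ 2 / binomialWeight N p k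
          - 2 * binomialWeight N s k + binomialWeight N p k := fun k => by
      have := (hpos k).ne'
      field_simp; ring
    simp_rw [h1]
    rw [Finset.sum_add_distrib, Finset.sum_sub_distrib, ← Finset.mul_sum, sum_binomialWeight,
      sum_binomialWeight, hchi, hbase]
    have h2 : (1 + (p - s) ^ 2 / (p * (1 - p))) ^ N
        ≤ Real.exp (N * (p - s) ^ 2 / (p * (1 - p))) := by
      rw [mul_div_assoc, Real.exp_nat_mul]
      refine pow_le_pow_left₀ (by positivity) ?_ N
      linarith [Real.add_one_le_exp ((p - s) ^ 2 / (p * (1 - p)))]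
    linarith
  have hcs := Finset.sum_sq_le_sum_mul_sum_of_sq_le_mul (Finset.univ : Finset (Fin (N + 1)))
    (r := fun k => |binomialWeight N s k - binomialWeight N p k|)
    (f := fun k => (binomialWeight N s k - binomialWeight N p k) ^ 2 / binomialWeight N p k)
    (g := fun k => binomialWeight N p k) (fun k _ => div_nonneg (sq_nonneg _) (hpos k).le)
    (fun k _ => (hpos k).le) (fun k _ => by
      exact (by rw [sq_abs, div_mul_cancel₀ _ (hpos k).ne'] : _ = _).le)
  rw [sum_binomialWeight, mul_one] at hcs
  have h3 : ∑ k : Fin (N + 1), |binomialWeight N s k - binomialWeight N p k|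
      ≤ √(Real.exp (N * (p - s) ^ 2 / (p * (1 - p))) - 1) := Real.le_sqrt_of_sq_le (hcs.trans hsum)
  have h4 : 0 ≤ ∑ k : Fin (N + 1), |binomialWeight N s k - binomialWeight N p k| :=
    Finset.sum_nonneg fun _ _ => abs_nonneg _
  rw [tvDist]
  linarith

/-- Lower bound for the total variation distance of two binomial laws by the means. -/
lemma sub_le_two_mul_tvDist_binomial (hN : 0 < N) :
    p - s ≤ 2 * tvDist (fun k : Fin (N + 1) => binomialWeight N s k)
      (fun k => binomialWeight N p k) := by
  have hN' : (0 : ℝ) < N := by exact_mod_cast hN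
  have h1 : N * (p - s) ≤ N * ∑ k : Fin (N + 1), |binomialWeight N s k - binomialWeight N p k| := by
    -- Test the two laws against k ↦ k, which lies in [0, N].
    rw [mul_sub, ← sum_mul_binomialWeight, ← sum_mul_binomialWeight, ← Finset.sum_sub_distrib,
      Finset.mul_sum]
    refine Finset.sum_le_sum fun k _ => ?_
    rw [← mul_sub, abs_sub_comm]
    exact (mul_le_mul_of_nonneg_left (le_abs_self _) (Nat.cast_nonneg _)).trans
      (mul_le_mul_of_nonneg_right (by exact_mod_cast Nat.lt_succ_iff.1 k.2) (abs_nonneg _))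
  rw [tvDist]
  linarith [le_of_mul_le_mul_left h1 hN']

end Comparison

/-! ### The Ehrenfest generator and its binomial laws. -/

section Generator

variable {lam mu : ℝ} {N : ℕ}

lemma ehrenfestGenerator_nonneg (hlam : 0 ≤ lam) (hmu : 0 ≤ mu) (i j : Fin (N + 1)) (hij : i ≠ j) :
    0 ≤ ehrenfestGenerator lam mu N i j := by
  have : ((i : ℕ) : ℝ) ≤ N := by exact_mod_cast Nat.lt_succ_iff.1 i.2
  rw [ehrenfestGenerator, Matrix.of_apply, if_neg hij]
  split_ifs
  · exact mul_nonneg hlam (by linarith)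
  · positivity
  · exact le_rfl

/-- Written as net flow in from the left minus net flow out to the right. Vanishing of w at N + 1
removes the upper boundary case. -/
lemma vecMul_ehrenfestGenerator (w : ℕ → ℝ) (hw : w (N + 1) = 0) (j : Fin (N + 1)) :
    ((fun i : Fin (N + 1) => w i) ᵥ* ehrenfestGenerator lam mu N) j =
      (if (j : ℕ) = 0 then 0 else
        lam * ((N - ((j - 1 : ℕ) : ℝ)) * w (j - 1)) - mu * ((((j - 1 : ℕ) : ℝ) + 1) * w j)) -
      (lam * ((N - (j : ℕ)) * w j) - mu * (((j : ℕ) + 1) * w (j + 1))) := by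
  have h1 : ((fun i : Fin (N + 1) => w i) ᵥ* ehrenfestGenerator lam mu N) j =
      ∑ i ∈ Finset.range (N + 1), ((if (j : ℕ) = i + 1 then w i * (lam * (N - i)) else 0) +
        (if i = j + 1 then w i * (mu * i) else 0) +
        (if i = j then w i * -(lam * (N - i) + mu * i) else 0)) := by
    rw [← Fin.sum_univ_eq_sum_range (fun i : ℕ =>
      ((if (j : ℕ) = i + 1 then w i * (lam * (N - i)) else 0) +
        (if i = j + 1 then w i * (mu * i) else 0) +
        (if i = j then w i * -(lam * (N - i) + mu * i) else 0)))]
    change ∑ i : Fin (N + 1), w i * ehrenfestGenerator lam mu N i j = _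
    refine Finset.sum_congr rfl fun i _ => ?_
    rw [ehrenfestGenerator, Matrix.of_apply]
    simp only [Fin.ext_iff]
    split_ifs <;> first | omega | simp
  rw [h1, Finset.sum_add_distrib, Finset.sum_add_distrib, Finset.sum_ite_eq', Finset.sum_ite_eq',
    if_pos (Finset.mem_range.2 j.2)]
  have h2 : (if (j : ℕ) + 1 ∈ Finset.range (N + 1) then w (j + 1) * (mu * ((j + 1 : ℕ) : ℝ)) else 0)
      = w (j + 1) * (mu * ((j + 1 : ℕ) : ℝ)) := by
    split_ifs with h
    · rfl
    · have : (j : ℕ) + 1 = N + 1 := by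
        have := j.2
        simp only [Finset.mem_range, not_lt] at h
        omega
      rw [this, hw, zero_mul]
  rw [h2]
  rcases hj : (j : ℕ) with _ | m
  · simp; ring
  · have hm : m ∈ Finset.range (N + 1) := Finset.mem_range.2 (by have := j.2; omega)
    have h3 : ∑ i ∈ Finset.range (N + 1), (if m + 1 = i + 1 then w i * (lam * (N - i)) else 0)
        = w m * (lam * (N - m)) := by
      simp only [Nat.add_right_cancel_iff]
      rw [Finset.sum_ite_eq, if_pos hm]
    rw [h3, if_neg (Nat.succ_ne_zero m), Nat.add_sub_cancel]
    push_cast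
    ring

/-- The out-of-range value g(N+1) and the truncated index at i = 0 are multiplied by zero rates. -/
lemma ehrenfestGenerator_mulVec (g : ℕ → ℝ) (i : Fin (N + 1)) :
    (ehrenfestGenerator lam mu N *ᵥ fun j : Fin (N + 1) => g j) i =
      lam * (N - (i : ℕ)) * (g (i + 1) - g i) + mu * (i : ℕ) * (g (i - 1) - g i) := by
  have h1 : (ehrenfestGenerator lam mu N *ᵥ fun j : Fin (N + 1) => g j) i =
      ∑ j ∈ Finset.range (N + 1), ((if j = i + 1 then lam * (N - (i : ℕ)) * g j else 0) +
        (if (i : ℕ) = j + 1 then mu * (i : ℕ) * g j else 0) +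
        (if j = i then -(lam * (N - (i : ℕ)) + mu * (i : ℕ)) * g j else 0)) := by
    rw [← Fin.sum_univ_eq_sum_range (fun j : ℕ =>
      ((if j = i + 1 then lam * (N - (i : ℕ)) * g j else 0) +
        (if (i : ℕ) = j + 1 then mu * (i : ℕ) * g j else 0) +
        (if j = i then -(lam * (N - (i : ℕ)) + mu * (i : ℕ)) * g j else 0)))]
    change ∑ j : Fin (N + 1), ehrenfestGenerator lam mu N i j * g j = _
    refine Finset.sum_congr rfl fun j _ => ?_
    rw [ehrenfestGenerator, Matrix.of_apply]
    simp only [Fin.ext_iff]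
    split_ifs <;> first | omega | simp
  rw [h1, Finset.sum_add_distrib, Finset.sum_add_distrib, Finset.sum_ite_eq', Finset.sum_ite_eq',
    if_pos (Finset.mem_range.2 i.2)]
  have h2 : (if (i : ℕ) + 1 ∈ Finset.range (N + 1) then lam * (N - (i : ℕ)) * g (i + 1) else 0)
      = lam * (N - (i : ℕ)) * g (i + 1) := by
    split_ifs with h
    · rfl
    · have : (i : ℕ) = N := by
        have := i.2
        simp only [Finset.mem_range, not_lt] at h
        omega
      rw [this]; simp
  rw [h2]
  rcases hi : (i : ℕ) with _ | m
  · simp; ring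
  · have hm : m ∈ Finset.range (N + 1) := Finset.mem_range.2 (by have := i.2; omega)
    simp only [Nat.add_right_cancel_iff]
    rw [Finset.sum_ite_eq, if_pos hm, Nat.add_sub_cancel]
    ring

/-- The success probability of the law of the process at time `t`. -/
noncomputable def successProb (lam mu t : ℝ) : ℝ :=
  lam / (lam + mu) * (1 - Real.exp (-((lam + mu) * t)))

/-- The net current is the flux times λ(1-s) - μs, so the forward equation becomes the chain rule
for s' = λ(1-s) - μs. -/
lemma vecMul_binomialWeight (s : ℝ) (j : Fin (N + 1)) :
    ((fun i : Fin (N + 1) => binomialWeight N s i) ᵥ* ehrenfestGenerator lam mu N) j =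
      ((if (j : ℕ) = 0 then 0 else binomialFlux N s (j - 1)) - binomialFlux N s j)
        * (lam * (1 - s) - mu * s) := by
  rw [vecMul_ehrenfestGenerator _ (binomialWeight_succ_self N s)]
  have hj : (j : ℕ) ≤ N := Nat.lt_succ_iff.1 j.2
  rw [sub_mul_binomialWeight hj, succ_mul_binomialWeight hj]
  split_ifs with h
  · ring
  · rw [sub_mul_binomialWeight (show (j : ℕ) - 1 ≤ N by omega)]
    have := succ_mul_binomialWeight (show (j : ℕ) - 1 ≤ N by omega) s
    rw [Nat.sub_add_cancel (by omega)] at this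
    rw [this]
    ring

/-- The law of the Ehrenfest process started at `0` is binomial. -/
lemma single_vecMul_exp (hsum : 0 < lam + mu) (t : ℝ) :
    (Pi.single 0 1 : Fin (N + 1) → ℝ) ᵥ* NormedSpace.exp (t • ehrenfestGenerator lam mu N) =
      fun k : Fin (N + 1) => binomialWeight N (successProb lam mu t) k := by
  have h := eq_vecMul_exp (Q := ehrenfestGenerator lam mu N)
    (b := fun t (k : Fin (N + 1)) => binomialWeight N (successProb lam mu t) k) (fun t k => by
      have hs : HasDerivAt (successProb lam mu)
          (lam * (1 - successProb lam mu t) - mu * successProb lam mu t) t := by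
        have h1 := (((hasDerivAt_id t).const_mul (lam + mu)).neg.exp.const_sub 1).const_mul
          (lam / (lam + mu))
        refine h1.congr_deriv ?_
        simp only [successProb, id, Pi.neg_apply]
        field_simp
        ring
      rw [vecMul_binomialWeight]
      exact (hasDerivAt_binomialWeight (Nat.lt_succ_iff.1 k.2) _).comp t hs) t
  rw [h]
  congr 1
  ext k
  by_cases hk : k = 0
  · subst hk
    simp [binomialWeight, successProb]
  · have : (k : ℕ) ≠ 0 := fun h => hk (Fin.ext h)
    simp [binomialWeight, successProb, hk, this]

/-- The stationary distribution of the Ehrenfest process is binomial. -/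
lemma IsStationary.eq_binomialWeight (hlam : 0 < lam) (hmu : 0 < mu) {π : Fin (N + 1) → ℝ}
    (hπ : IsStationary (ehrenfestGenerator lam mu N) π) :
    π = fun k : Fin (N + 1) => binomialWeight N (lam / (lam + mu)) k := by
  set p := lam / (lam + mu) with hp
  set w : ℕ → ℝ := fun k => if h : k < N + 1 then π ⟨k, h⟩ else 0 with hw
  have hwπ : (fun i : Fin (N + 1) => w i) = π := by
    ext i
    exact dif_pos i.2
  have hw0 : w (N + 1) = 0 := by simp [hw]
  -- No current enters at 0, so invariance forces zero current across each successive edge: detailed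
  -- balance.
  have hflux : ∀ k < N + 1, lam * ((N - (k : ℝ)) * w k) = mu * (((k : ℝ) + 1) * w (k + 1)) := by
    intro k
    induction k with
    | zero =>
      intro hk
      have := vecMul_ehrenfestGenerator (lam := lam) (mu := mu) w hw0 ⟨0, hk⟩
      rw [hwπ, hπ.invariant] at this
      simp only [Pi.zero_apply, if_true] at this
      linarith
    | succ k ih =>
      intro hk
      have := vecMul_ehrenfestGenerator (lam := lam) (mu := mu) w hw0 ⟨k + 1, hk⟩
      rw [hwπ, hπ.invariant] at this
      simp only [Pi.zero_apply, Nat.succ_ne_zero, if_false, Nat.add_sub_cancel] at this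
      have := ih (by omega)
      linarith
  have hq : lam * (1 - p) = mu * p := by rw [hp]; field_simp; ring
  have hprop : ∀ k < N + 1, w k * binomialWeight N p 0 = w 0 * binomialWeight N p k := by
    intro k
    induction k with
    | zero => intro _; rfl
    | succ k ih =>
      intro hk
      have h1 := ih (by omega)
      have h2 := hflux k (by omega)
      have h3 := sub_mul_binomialWeight (show k ≤ N by omega) p
      have h4 := succ_mul_binomialWeight (show k ≤ N by omega) p
      have hne : mu * ((k : ℝ) + 1) ≠ 0 := by positivity
      apply mul_left_cancel₀ hne
      linear_combination (-binomialWeight N p 0) * h2 + lam * (N - k) * h1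
        + lam * w 0 * h3 - mu * w 0 * h4 + w 0 * binomialFlux N p k * hq
  have hsum : ∑ k : Fin (N + 1), w k = 1 := by
    have : ∑ k : Fin (N + 1), w k = ∑ k, π k := Finset.sum_congr rfl fun k _ => congrFun hwπ k
    rw [this, hπ.sum_eq_one]
  have h0 : binomialWeight N p 0 = w 0 := by
    have h := Finset.sum_congr rfl fun (k : Fin (N + 1)) (_ : k ∈ Finset.univ) => hprop k k.2
    rw [← Finset.sum_mul, ← Finset.mul_sum, hsum, sum_binomialWeight] at h
    linarith
  have hp0 : 0 < p := by positivity
  have hp1 : p < 1 := by rw [hp, div_lt_one (by positivity)]; linarith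
  have hpos := binomialWeight_pos hp0 hp1 (Nat.zero_le N)
  rw [← hwπ]
  ext k
  have := hprop k k.2
  rw [← h0, mul_comm] at this
  exact mul_left_cancel₀ hpos.ne' this

end Generator

end EhrenfestCutoff
namespace EhrenfestCutoff

/-! ### Halting states and cutoff of the Ehrenfest process. -/

section Ehrenfest

variable {Ω : Type*} [MeasurableSpace Ω] {P : Measure Ω} [IsProbabilityMeasure P] {lam mu : ℝ}
  {N : ℕ} {X : ℝ≥0 → Ω → Fin (N + 1)} {π : Fin (N + 1) → ℝ}

lemma sub_successProb (lam mu t : ℝ) : lam / (lam + mu) - successProb lam mu t =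
    lam / (lam + mu) * Real.exp (-((lam + mu) * t)) := by
  rw [successProb]; ring

lemma successProb_nonneg (hlam : 0 < lam) (hmu : 0 < mu) {t : ℝ} (ht : 0 ≤ t) :
    0 ≤ successProb lam mu t := by
  have : Real.exp (-((lam + mu) * t)) ≤ 1 :=
    Real.exp_le_one_iff.2 (neg_nonpos.2 (by positivity))
  exact mul_nonneg (by positivity) (by linarith)

lemma successProb_lt (hlam : 0 < lam) (hmu : 0 < mu) (t : ℝ) :
    successProb lam mu t < lam / (lam + mu) := by
  have : 0 < lam / (lam + mu) * Real.exp (-((lam + mu) * t)) := by positivity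
  linarith [sub_successProb lam mu t]

lemma limitProb_pos (hlam : 0 < lam) (hmu : 0 < mu) : 0 < lam / (lam + mu) := by positivity

lemma limitProb_lt_one (hlam : 0 < lam) (hmu : 0 < mu) : lam / (lam + mu) < 1 := by
  rw [div_lt_one (by positivity)]; linarith

lemma exists_successProb_eq (hlam : 0 < lam) (hmu : 0 < mu) {a : ℝ} (h0 : 0 ≤ a)
    (h1 : a < lam / (lam + mu)) : ∃ t : ℝ≥0, successProb lam mu t = a := by
  have hp := limitProb_pos hlam hmu
  have h2 : 0 < 1 - a / (lam / (lam + mu)) := by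
    rw [sub_pos, div_lt_one hp]; exact h1
  have h3 : 1 - a / (lam / (lam + mu)) ≤ 1 := by
    have : 0 ≤ a / (lam / (lam + mu)) := by positivity
    linarith
  refine ⟨NNReal.mk (-Real.log (1 - a / (lam / (lam + mu))) / (lam + mu))
    (div_nonneg (neg_nonneg.2 (Real.log_nonpos h2.le h3)) (by positivity)), ?_⟩
  rw [successProb, NNReal.coe_mk, mul_div_cancel₀ _ (by positivity : lam + mu ≠ 0), neg_neg,
    Real.exp_log h2, sub_sub_cancel, mul_div_cancel₀ _ hp.ne']

lemma IsEhrenfestProcess.law_eq (hX : IsEhrenfestProcess P lam mu N X) (hlam : 0 < lam)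
    (hmu : 0 < mu) (t : ℝ≥0) :
    law P X t = fun k : Fin (N + 1) => binomialWeight N (successProb lam mu t) k := by
  rw [IsMarkovChain.law_eq hX, single_vecMul_exp (by positivity)]

lemma IsEhrenfestProcess.dist_eq (hX : IsEhrenfestProcess P lam mu N X) (hlam : 0 < lam)
    (hmu : 0 < mu) (hπ : IsStationary (ehrenfestGenerator lam mu N) π) (t : ℝ≥0) :
    dist P X π t = tvDist (fun k : Fin (N + 1) => binomialWeight N (successProb lam mu t) k)
      (fun k => binomialWeight N (lam / (lam + mu)) k) := by
  rw [dist, hX.law_eq hlam hmu, hπ.eq_binomialWeight hlam hmu]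

/-- If x/N < p, the maximising parameter x/N is attained at a finite time, when the law strictly
exceeds π at x. Otherwise s(t) < p ≤ x/N, on the increasing side of the likelihood. -/
lemma IsEhrenfestProcess.mem_dominatedStates_iff (hX : IsEhrenfestProcess P lam mu N X)
    (hlam : 0 < lam) (hmu : 0 < mu) (hπ : IsStationary (ehrenfestGenerator lam mu N) π)
    (x : Fin (N + 1)) :
    x ∈ dominatedStates P X π ↔ N * (lam / (lam + mu)) ≤ (x : ℕ) := by
  have hp := limitProb_pos hlam hmu
  have hp1 := limitProb_lt_one hlam hmu
  have hx : (x : ℕ) ≤ N := Nat.lt_succ_iff.1 x.2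
  rw [dominatedStates, Set.mem_ofPred_eq, hπ.eq_binomialWeight hlam hmu]
  simp only [hX.law_eq hlam hmu]
  constructor
  · intro h
    by_contra! hlt
    have hN : 0 < N := by
      rcases Nat.eq_zero_or_pos N with rfl | h
      · simp at hlt
      · exact h
    have hN' : (0 : ℝ) < N := by exact_mod_cast hN
    obtain ⟨t, ht⟩ := exists_successProb_eq hlam hmu (a := ((x : ℕ) : ℝ) / N) (by positivity)
      (by rw [div_lt_iff₀ hN']; linarith)
    have h1 := h t
    rw [ht] at h1
    exact absurd h1 (not_le.2 (binomialWeight_lt_of_lt_mean hp1 hN hlt))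
  · intro h t
    exact binomialWeight_le_of_mean_le hp hp1 (successProb_nonneg hlam hmu t.2)
      (successProb_lt hlam hmu t).le hx h

lemma IsEhrenfestProcess.law_zero (hX : IsEhrenfestProcess P lam mu N X) :
    law P X 0 = Pi.single 0 1 := by
  rw [IsMarkovChain.law_eq hX]
  simp

/-- States above the stationary mean are halting states. -/
lemma IsEhrenfestProcess.isHaltingState (hX : IsEhrenfestProcess P lam mu N X)
    (hlam : 0 < lam) (hmu : 0 < mu) (hπ : IsStationary (ehrenfestGenerator lam mu N) π)
    {x : Fin (N + 1)} (hx : N * (lam / (lam + mu)) ≤ (x : ℕ)) : IsHaltingState P X π x :=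
  IsMarkovChain.isHaltingState_of_isHaltingSet hX hx
    (IsMarkovChain.isHaltingSet_of_subset_dominatedStates hX
      (ehrenfestGenerator_nonneg hlam.le hmu.le) hπ
      (A := {y : Fin (N + 1) | N * (lam / (lam + mu)) ≤ (y : ℕ)})
      fun y hy => (hX.mem_dominatedStates_iff hlam hmu hπ y).2 hy)

/-- Hitting times of states below the stationary mean have tails decaying strictly faster than the
distance to stationarity. -/
lemma IsEhrenfestProcess.hitting_tail_le (hX : IsEhrenfestProcess P lam mu N X)
    (hlam : 0 < lam) (hmu : 0 < mu) {x : Fin (N + 1)} (hx0 : 0 < (x : ℕ))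
    (hx : (x : ℕ) < N * (lam / (lam + mu))) :
    ∃ γ > lam + mu, ∀ t : ℝ≥0, P.real {ω | (t : WithTop ℝ≥0) < hittingAfter X {x} 0 ω}
      ≤ Real.exp (-γ * t) * (x : ℕ) := by
  have hx0' : (0 : ℝ) < (x : ℕ) := by exact_mod_cast hx0
  -- For g(i) = x - i the drift is -λN + (λ+μ)i ≤ -γ₁(x - i), with equality at i = 0, and x < Np
  -- means γ₁ > λ+μ.
  set γ₁ : ℝ := lam * N / (x : ℕ) with hγ₁
  have hγx : γ₁ * (x : ℕ) = lam * N := by rw [hγ₁]; field_simp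
  have hγ : lam + mu < γ₁ := by
    rw [hγ₁, lt_div_iff₀ hx0']
    have : (x : ℕ) * (lam + mu) < N * (lam / (lam + mu)) * (lam + mu) :=
      mul_lt_mul_of_pos_right hx (by positivity)
    have h2 : N * (lam / (lam + mu)) * (lam + mu) = lam * N := by field_simp
    linarith
  -- A rate strictly below γ₁ is taken because the Lyapunov condition must be strict.
  refine ⟨(lam + mu + γ₁) / 2, by linarith, fun t => ?_⟩
  have hmain := IsMarkovChain.measureReal_lt_hittingAfter_le hX
    (ehrenfestGenerator_nonneg hlam.le hmu.le) (A := Set.Ici x) (x := x)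
    (fun i hi j hj hjx => by
      have h1 : (i : ℕ) < x := not_le.1 hi
      have h2 : (x : ℕ) < j := lt_of_le_of_ne hj fun h => hjx (Fin.ext h.symm)
      rw [ehrenfestGenerator, Matrix.of_apply, if_neg (by omega), if_neg (by omega),
        if_neg fun h => by subst h; omega])
    (fun j hj => by
      have h1 : j ≠ 0 := fun h => by
        have : (x : ℕ) ≤ j := hj
        rw [h, Fin.val_zero] at this
        omega
      rw [hX.law_zero, Pi.single_eq_of_ne h1])
    (g := fun i : Fin (N + 1) => (((x : ℕ) - (i : ℕ) : ℕ) : ℝ))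
    (fun i hi => by
      have : (x : ℕ) ≤ i := hi
      simp [Nat.sub_eq_zero_of_le this])
    (fun i hi => by
      have : (i : ℕ) < x := not_le.1 hi
      exact_mod_cast (show 1 ≤ (x : ℕ) - (i : ℕ) by omega))
    (γ := (lam + mu + γ₁) / 2)
    (fun i hi => by
      have hix : (i : ℕ) < x := not_le.1 hi
      rw [ehrenfestGenerator_mulVec (fun k : ℕ => (((x : ℕ) - k : ℕ) : ℝ))]
      have e0 : (((x : ℕ) - (i : ℕ) : ℕ) : ℝ) = (x : ℕ) - (i : ℕ) := Nat.cast_sub hix.le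
      have e1 : (((x : ℕ) - ((i : ℕ) + 1) : ℕ) : ℝ) = (x : ℕ) - (i : ℕ) - 1 := by
        rw [Nat.cast_sub hix]; push_cast; ring
      have e2 : mu * (i : ℕ) * ((((x : ℕ) - ((i : ℕ) - 1) : ℕ) : ℝ) - ((x : ℕ) - (i : ℕ)))
          = mu * (i : ℕ) := by
        rcases Nat.eq_zero_or_pos (i : ℕ) with h | h
        · simp [h]
        · rw [Nat.cast_sub (by omega), Nat.cast_sub h]; push_cast; ring
      rw [e0, e1, e2]
      have hd : (0 : ℝ) < (x : ℕ) - (i : ℕ) := by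
        have : ((i : ℕ) : ℝ) < (x : ℕ) := by exact_mod_cast hix
        linarith
      have h3 : (lam + mu + γ₁) / 2 * ((x : ℕ) - (i : ℕ)) < γ₁ * ((x : ℕ) - (i : ℕ)) :=
        mul_lt_mul_of_pos_right (by linarith) hd
      have h4 : (lam + mu) * (i : ℕ) ≤ γ₁ * (i : ℕ) :=
        mul_le_mul_of_nonneg_right hγ.le (Nat.cast_nonneg _)
      linarith) t
  refine hmain.trans (le_of_eq ?_)
  rw [hX.law_zero]
  simp [Pi.single_apply]

/-- States below the stationary mean are not halting states. -/
lemma IsEhrenfestProcess.le_of_isHaltingState (hX : IsEhrenfestProcess P lam mu N X)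
    (hlam : 0 < lam) (hmu : 0 < mu) (hπ : IsStationary (ehrenfestGenerator lam mu N) π)
    {x : Fin (N + 1)} (hx : IsHaltingState P X π x) : N * (lam / (lam + mu)) ≤ (x : ℕ) := by
  by_contra! hlt
  have hp := limitProb_pos hlam hmu
  have hN : 0 < N := by
    rcases Nat.eq_zero_or_pos N with rfl | h
    · simp at hlt
    · exact h
  have hlow : ∀ t : ℝ≥0, lam / (lam + mu) * Real.exp (-((lam + mu) * t)) ≤
      2 * P.real {ω | (t : WithTop ℝ≥0) < hittingAfter X {x} 0 ω} := fun t => by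
    have h1 := sub_le_two_mul_tvDist_binomial (s := successProb lam mu t)
      (p := lam / (lam + mu)) hN
    rw [← hX.dist_eq hlam hmu hπ, sub_successProb] at h1
    linarith [hx t]
  rcases Nat.eq_zero_or_pos (x : ℕ) with h0 | hpos
  -- The chain starts at 0, so the hitting tail vanishes at t = 0 while d(0) ≥ p/2.
  · obtain rfl : x = 0 := Fin.ext h0
    have hnull : P.real {ω | ((0 : ℝ≥0) : WithTop ℝ≥0) < hittingAfter X {0} 0 ω} ≤ 0 := by
      have h1 : P.real {ω | X 0 ω = 0} = 1 := by
        have := congrFun hX.law_zero 0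
        simpa [law] using this
      have h2 : P.real {ω | X 0 ω = 0}ᶜ = 0 := by
        rw [probReal_compl_eq_one_sub (hX.measurable 0 0), h1, sub_self]
      rw [← h2]
      refine measureReal_mono fun ω hω => ?_
      rw [Set.mem_ofPred_eq, IsMarkovChain.lt_hittingAfter_iff hX] at hω
      exact hω 0 le_rfl
    have := hlow 0
    simp only [NNReal.coe_zero, mul_zero, neg_zero, Real.exp_zero, mul_one] at this
    linarith
  · obtain ⟨γ, hγ, htail⟩ := hX.hitting_tail_le hlam hmu hpos hlt
    set p := lam / (lam + mu)
    set δ := γ - (lam + mu) with hδ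
    have hδ0 : 0 < δ := sub_pos.2 hγ
    -- Chosen so that pδt = 2x; then p e^{δt} ≥ p(δt + 1) > 2x contradicts the tail bound.
    let t : ℝ≥0 := NNReal.mk (2 * (x : ℕ) / (p * δ)) (by positivity)
    have h1 := (hlow t).trans (mul_le_mul_of_nonneg_left (htail t) two_pos.le)
    have h2 : Real.exp (-((lam + mu) * t)) = Real.exp (-γ * t) * Real.exp (δ * t) := by
      rw [← Real.exp_add, hδ]; ring_nf
    rw [h2] at h1
    have h3 : p * Real.exp (δ * t) ≤ 2 * (x : ℕ) := by
      refine le_of_mul_le_mul_left ?_ (Real.exp_pos (-γ * t))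
      linarith
    have h4 : p * (δ * t + 1) ≤ p * Real.exp (δ * t) :=
      mul_le_mul_of_nonneg_left (Real.add_one_le_exp _) hp.le
    have h5 : p * (δ * t) = 2 * (x : ℕ) := by
      change p * (δ * (2 * (x : ℕ) / (p * δ))) = _
      field_simp
    linarith

lemma isLeast_ceil_of_mem_iff (hlam : 0 < lam) (hmu : 0 < mu) {s : Set (Fin (N + 1))}
    (hs : ∀ x, x ∈ s ↔ N * (lam / (lam + mu)) ≤ (x : ℕ)) :
    IsLeast ((fun x : Fin (N + 1) => (x : ℕ)) '' s) ⌈lam * (N : ℝ) / (lam + mu)⌉₊ := by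
  have he : lam * (N : ℝ) / (lam + mu) = N * (lam / (lam + mu)) := by ring
  rw [he]
  have hle : ⌈(N : ℝ) * (lam / (lam + mu))⌉₊ ≤ N :=
    Nat.ceil_le.2 (mul_le_of_le_one_right (Nat.cast_nonneg N) (limitProb_lt_one hlam hmu).le)
  refine ⟨⟨⟨_, Nat.lt_succ_iff.2 hle⟩, (hs _).2 (Nat.le_ceil _), rfl⟩, ?_⟩
  rintro _ ⟨x, hx, rfl⟩
  exact Nat.ceil_le.2 ((hs x).1 hx)

lemma exp_cutoff_time (hsum : 0 < lam + mu) (c : ℝ≥0) (N : ℕ) :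
    (lam + mu) * ((c * (Real.log (N : ℝ) / (2 * (lam + mu))).toNNReal : ℝ≥0) : ℝ)
      = c / 2 * Real.log N := by
  rw [NNReal.coe_mul, Real.coe_toNNReal _ (div_nonneg (Real.log_natCast_nonneg N) (by positivity))]
  field_simp

/-- This is the squared gap of the means in units of N, the quantity in both distance bounds; its
exponent changes sign at c = 1. -/
lemma nat_mul_sq_sub_successProb (hsum : 0 < lam + mu) (c : ℝ≥0) {N : ℕ} (hN : 0 < N) :
    N * (lam / (lam + mu) - successProb lam mu
      ((c * (Real.log (N : ℝ) / (2 * (lam + mu))).toNNReal : ℝ≥0) : ℝ)) ^ 2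
      = (lam / (lam + mu)) ^ 2 * Real.exp ((1 - c) * Real.log N) := by
  have hN' : (0 : ℝ) < N := by exact_mod_cast hN
  rw [sub_successProb, exp_cutoff_time hsum, mul_pow, ← Real.exp_nat_mul]
  have : Real.exp ((1 - c) * Real.log N) = N * Real.exp ((2 : ℕ) * -(c / 2 * Real.log N)) := by
    nth_rewrite 2 [← Real.exp_log hN']
    rw [← Real.exp_add]
    congr 1
    push_cast
    ring
  rw [this]
  ring

end Ehrenfest

lemma hasCutoff_ehrenfest {lam mu : ℝ} (hlam : 0 < lam) (hmu : 0 < mu)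
    {Ω : ℕ → Type*} [∀ N, MeasurableSpace (Ω N)]
    {P : ∀ N, Measure (Ω N)} [∀ N, IsProbabilityMeasure (P N)]
    {X : ∀ N, ℝ≥0 → Ω N → Fin (N + 1)} (hX : ∀ N, IsEhrenfestProcess (P N) lam mu N (X N))
    {π : ∀ N, Fin (N + 1) → ℝ} (hπ : ∀ N, IsStationary (ehrenfestGenerator lam mu N) (π N)) :
    HasCutoff (fun N t => dist (P N) (X N) (π N) t)
      (fun N => (Real.log (N : ℝ) / (2 * (lam + mu))).toNNReal) := by
  have hp := limitProb_pos hlam hmu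
  have hp1 := limitProb_lt_one hlam hmu
  have hsum : 0 < lam + mu := by positivity
  have hlog : Tendsto (fun N : ℕ => Real.log (N : ℝ)) atTop atTop :=
    Real.tendsto_log_atTop.comp tendsto_natCast_atTop_atTop
  constructor
  · intro c hc
    have hc' : (1 : ℝ) - c < 0 := sub_neg.2 (by exact_mod_cast hc)
    have hexp : Tendsto (fun N : ℕ => Real.exp ((1 - c) * Real.log N)) atTop (𝓝 0) :=
      Real.tendsto_exp_atBot.comp (hlog.const_mul_atTop_of_neg hc')
    have hcont : Continuous fun u : ℝ => √(Real.exp ((lam / (lam + mu)) ^ 2 * u /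
      (lam / (lam + mu) * (1 - lam / (lam + mu)))) - 1) := by fun_prop
    have hlim := (hcont.tendsto 0).comp hexp
    simp only [mul_zero, zero_div, Real.exp_zero, sub_self, Real.sqrt_zero] at hlim
    refine squeeze_zero' (Eventually.of_forall fun N => ?_) ?_ hlim
    · exact mul_nonneg (by norm_num) (Finset.sum_nonneg fun _ _ => abs_nonneg _)
    · filter_upwards [eventually_gt_atTop 0] with N hN
      rw [(hX N).dist_eq hlam hmu (hπ N)]
      refine (tvDist_binomial_le hp hp1).trans (le_of_eq ?_)
      rw [nat_mul_sq_sub_successProb hsum c hN]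
      rfl
  · intro c hc
    have hc' : (0 : ℝ) < 1 - c := sub_pos.2 (by exact_mod_cast hc)
    have hexp : Tendsto (fun N : ℕ => (lam / (lam + mu)) ^ 2 * Real.exp ((1 - c) * Real.log N))
        atTop atTop :=
      (Real.tendsto_exp_atTop.comp (hlog.const_mul_atTop hc')).const_mul_atTop (by positivity)
    have hlim := (hexp.const_div_atTop 2).const_sub 1
    rw [sub_zero] at hlim
    refine tendsto_of_tendsto_of_tendsto_of_le_of_le' hlim tendsto_const_nhds ?_
      (Eventually.of_forall fun N => ?_)
    · filter_upwards [eventually_gt_atTop 0] with N hN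
      rw [(hX N).dist_eq hlam hmu (hπ N), ← nat_mul_sq_sub_successProb hsum c hN]
      exact one_sub_le_tvDist_binomial (successProb_nonneg hlam hmu (NNReal.coe_nonneg _))
        ((successProb_lt hlam hmu _).le.trans hp1.le) (successProb_lt hlam hmu _) hp1.le hN
    -- The trivial bound d ≤ 1, from dominating π_t - π by π_t.
    · have h1 := (hX N).sum_law (c * (Real.log (N : ℝ) / (2 * (lam + mu))).toNNReal)
      refine (tvDist_le_sum h1 (hπ N).sum_eq_one (fun x => measureReal_nonneg)
        fun x => ?_).trans h1.le
      exact sub_le_self _ ((hπ N).nonneg x)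

end EhrenfestCutoff

theorem mainTheorem12
    (lam mu : ℝ) (hlam : 0 < lam) (hmu : 0 < mu)
    (Ω : ℕ → Type*) [∀ N, MeasurableSpace (Ω N)]
    (P : ∀ N, Measure (Ω N)) [∀ N, IsProbabilityMeasure (P N)]
    (X : ∀ N, ℝ≥0 → Ω N → Fin (N + 1))
    (hX : ∀ N, EhrenfestCutoff.IsEhrenfestProcess (P N) lam mu N (X N))
    (π : ∀ N, Fin (N + 1) → ℝ)
    (hπ : ∀ N, EhrenfestCutoff.IsStationary (EhrenfestCutoff.ehrenfestGenerator lam mu N) (π N)) :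
    (∀ N : ℕ,
      IsLeast ((fun x : Fin (N + 1) => (x : ℕ)) ''
          {x | EhrenfestCutoff.IsHaltingState (P N) (X N) (π N) x})
        ⌈lam * (N : ℝ) / (lam + mu)⌉₊ ∧
      IsLeast ((fun x : Fin (N + 1) => (x : ℕ)) ''
          EhrenfestCutoff.dominatedStates (P N) (X N) (π N))
        ⌈lam * (N : ℝ) / (lam + mu)⌉₊) ∧
    EhrenfestCutoff.HasCutoff
      (fun N t => EhrenfestCutoff.dist (P N) (X N) (π N) t)
      (fun N => (Real.log (N : ℝ) / (2 * (lam + mu))).toNNReal) := by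
  refine ⟨fun N => ⟨?_, ?_⟩, EhrenfestCutoff.hasCutoff_ehrenfest hlam hmu hX hπ⟩
  · exact EhrenfestCutoff.isLeast_ceil_of_mem_iff hlam hmu fun x =>
      ⟨fun h => (hX N).le_of_isHaltingState hlam hmu (hπ N) h,
        fun h => (hX N).isHaltingState hlam hmu (hπ N) h⟩
  · exact EhrenfestCutoff.isLeast_ceil_of_mem_iff hlam hmu
      ((hX N).mem_dominatedStates_iff hlam hmu (hπ N))
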